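/- Let $k$ be a field and let $V,W$ be $k$-vector spaces (of arbitrary dimension) with braidings, i.e. automorphisms $c_V\in\mathrm{Aut}(V\otimes V)$, $c_W\in\mathrm{Aut}(W\otimes W)$ satisfying the braid equation $(c\otimes\mathrm{id})(\mathrm{id}\otimes c)(c\otimes\mathrm{id})=(\mathrm{id}\otimes c)(c\otimes\mathrm{id})(\mathrm{id}\otimes c)$. Let the braid group $\mathbb B_n$ act on $V^{\otimes n}$ by $\sigma_i\mapsto \mathrm{id}^{\otimes(i-1)}\otimes c_V\otimes\mathrm{id}^{\otimes(n-i-1)}$, let $s:\mathbb S_n\to\mathbb B_n$ be the section sending a reduced word $\tau_{i_1}\cdots\tau_{i_j}$ in the transpositions $\tau_i=(i,i+1)$ to $\sigma_{i_1}\cdots\sigma_{i_j}$, and for $X\subseteq\mathbb S_n$ put $\mathfrak S_X=\sum_{x\in X}s(x)\in\mathrm{End}(V^{\otimes n})$. Put $\mathfrak S^n=\mathfrak S_{\mathbb S_n}$, $\mathfrak S=\bigoplus_n\mathfrak S^n$, and $\mathfrak S_{p,q}=\mathfrak S_{X_{p,q}}$ with $$X_{p,q}=\{x\in\mathbb S_{p+q}\mid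 x^{-1}(1)<\dots<x^{-1}(p),\ x^{-1}(p+1)<\dots<x^{-1}(p+q)\}.$$ Let $A(V)=\bigoplus_n V^{\otimes n}$ be the tensor algebra, with comultiplication given on $V^{\otimes n}$ by $\sum_{p+q=n}\mathfrak S_{p,q}$, where $\mathfrak S_{p,q}:V^{\otimes n}\to V^{\otimes p}\otimes V^{\otimes q}$. Then $\ker\mathfrak S$ is a graded two-sided ideal and a coideal of $A(V)$, and $\mathfrak B(V)=A(V)/\ker\mathfrak S=\bigoplus_n V^{\otimes n}/\ker\mathfrak S^n=\bigoplus_n\mathfrak B^n(V)$ carries the induced multiplication and comultiplication $\Delta(u)=u_{(1)}\otimes u_{(2)}$ (Sweedler notation); the same applies to $W$. Let $(\,|\,):V\otimes W\to k$ be a nondegenerate bilinear form (both radicals are zero) such that $(c_V(x)\,|\,y)=(x\,|\,c_W(y))$ for all $x\in V\otimes V$, $y\in W\otimes W$, where the form on $(V\otimes V)\otimes(W\otimes W)$ is * case (a): $(v_1\otimes v_2\,|\,w_1\otimes w_2)=(v_1|w_1)(v_2|w_2)$, or * case (b): $(v_1\otimes v_2\,|\,w_1\otimes w_2)=(v_1|w_2)(v_2|w_1)$.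 Then in each of the two cases there is a unique nondegenerate bilinear form $[\,,]:\mathfrak B(V)\otimes\mathfrak B(W)\to k$ such that 1. $[1,1]=1$; 2. $[\mathfrak B^i(V),\mathfrak B^j(W)]=0$ if $i\ne j$; 3. $[v,w]=(v|w)$ for $v\in\mathfrak B^1(V)=V$, $w\in\mathfrak B^1(W)=W$; 4. $[u,zz']=[u_{(1)},z][u_{(2)},z']$ in case (a), and $[u,zz']=[u_{(1)},z'][u_{(2)},z]$ in case (b), for all $u\in\mathfrak B(V)$, $z,z'\in\mathfrak B(W)$; 5. $[uu',z]=[u,z_{(1)}][u',z_{(2)}]$ in case (a), and $[uu',z]=[u,z_{(2)}][u',z_{(1)}]$ in case (b), for all $u,u'\in\mathfrak B(V)$, $z\in\mathfrak B(W)$. Moreover, define a bilinear form on $A(V)\otimes A(W)$ by $[u,z]=0$ if $u,z$ are homogeneous of different degrees, and, for $u\in V^{\otimes n}$, $z\in W^{\otimes n}$, by $[u,z]=(\mathfrak S^nu\,|\,z)$, where $(v_1\otimes\cdots\otimes v_n\,|\,w_1\otimes\cdots\otimes w_n)$ is $\prod_i(v_i|w_i)$ in case (a) and $\prod_i(v_i|w_{n+1-i})$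 in case (b). Then the left radical of this form is $\ker(\mathfrak S:A(V)\to A(V))$, its right radical is $\ker(\mathfrak S:A(W)\to A(W))$, and the form it induces on the quotients $\mathfrak B(V)\otimes\mathfrak B(W)$ is the unique pairing above. In particular $\mathfrak B(V)$ and $\mathfrak B(W)$ are the quotients of $A(V)$ and $A(W)$ by the left and right radicals. -/

import Mathlib

open scoped TensorProduct DirectSum

namespace BraidedHopf

/-! ## The symmetric group, the braid group, and the section between them -/

section Braid

variable {n : ℕ}

/-- The first position moved by the `i`-th elementary transposition. -/
def posL (i : Fin (n - 1)) : Fin n := ⟨i, by omega⟩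

/-- The second position moved by the `i`-th elementary transposition. -/
def posR (i : Fin (n - 1)) : Fin n := ⟨i + 1, by omega⟩

/-- The elementary transposition `τ_i = (i, i+1)`. -/
def tau (i : Fin (n - 1)) : Equiv.Perm (Fin n) := Equiv.swap (posL i) (posR i)

/-- The defining relations of the Artin braid group. -/
inductive BraidRel (n : ℕ) : FreeGroup (Fin (n - 1)) → Prop
  | far (i j : Fin (n - 1)) (h : (i : ℕ) + 1 < j) :
      BraidRel n (FreeGroup.of i * FreeGroup.of j * (FreeGroup.of j * FreeGroup.of i)⁻¹)
  | near (i j : Fin (n - 1)) (h : (i : ℕ) + 1 = j) :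
      BraidRel n (FreeGroup.of i * FreeGroup.of j * FreeGroup.of i *
        (FreeGroup.of j * FreeGroup.of i * FreeGroup.of j)⁻¹)

/-- The Artin braid group on `n` strands. -/
abbrev BraidGroup (n : ℕ) : Type := PresentedGroup {r | BraidRel n r}

/-- The generator `σ_i` of the braid group. -/
def sigma (i : Fin (n - 1)) : BraidGroup n := PresentedGroup.of i

theorem sigma_far (i j : Fin (n - 1)) (h : (i : ℕ) + 1 < j) :
    sigma i * sigma j = sigma j * sigma i := by
  have := PresentedGroup.one_of_mem (rels := {r | BraidRel n r}) (BraidRel.far i j h)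
  rw [map_mul, map_inv, mul_inv_eq_one] at this
  exact this

theorem sigma_near (i j : Fin (n - 1)) (h : (i : ℕ) + 1 = j) :
    sigma i * sigma j * sigma i = sigma j * sigma i * sigma j := by
  have := PresentedGroup.one_of_mem (rels := {r | BraidRel n r}) (BraidRel.near i j h)
  rw [map_mul, map_inv, mul_inv_eq_one] at this
  exact this

/-- `l` is a word of minimal length in the elementary transpositions representing `x`. -/
def IsReducedWord (l : List (Fin (n - 1))) (x : Equiv.Perm (Fin n)) : Prop :=
  (l.map tau).prod = x ∧ ∀ l' : List (Fin (n - 1)), (l'.map tau).prod = x → l.length ≤ l'.length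

/-- Pairs of positions that `x⁻¹` puts in the wrong order. -/
def invSet (x : Equiv.Perm (Fin n)) : Finset (Fin n × Fin n) :=
  Finset.univ.filter fun p => p.1 < p.2 ∧ x.symm p.2 < x.symm p.1

/-- `i` is a left descent of `x`. -/
def Desc (i : Fin (n - 1)) (x : Equiv.Perm (Fin n)) : Prop := x.symm (posR i) < x.symm (posL i)

theorem posL_lt_posR (i : Fin (n - 1)) : posL i < posR i := by simp [posL, posR, Fin.lt_def]

theorem tau_mul_self (i : Fin (n - 1)) : tau i * tau i = 1 := Equiv.swap_mul_self _ _

theorem tau_mul_tau_mul (i : Fin (n - 1)) (x : Equiv.Perm (Fin n)) : tau i * (tau i * x) = x := by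
  rw [← mul_assoc, tau_mul_self, one_mul]

theorem tau_mul_symm_apply (i : Fin (n - 1)) (x : Equiv.Perm (Fin n)) (a : Fin n) :
    (tau i * x).symm a = x.symm (tau i a) := by
  rw [Equiv.symm_apply_eq, Equiv.Perm.mul_apply, Equiv.apply_symm_apply]
  simp [tau]

@[simp] theorem tau_posL (i : Fin (n - 1)) : tau i (posL i) = posR i := Equiv.swap_apply_left _ _
@[simp] theorem tau_posR (i : Fin (n - 1)) : tau i (posR i) = posL i := Equiv.swap_apply_right _ _

theorem tau_of_ne (i : Fin (n - 1)) (a : Fin n) (h₁ : (a : ℕ) ≠ i) (h₂ : (a : ℕ) ≠ i + 1) :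
    tau i a = a :=
  Equiv.swap_apply_of_ne_of_ne (by simpa [posL, Fin.ext_iff] using h₁)
    (by simpa [posR, Fin.ext_iff] using h₂)

theorem tau_lt_tau (i : Fin (n - 1)) (a b : Fin n) (h : a < b)
    (hne : ¬ (a = posL i ∧ b = posR i)) : tau i a < tau i b := by
  simp only [tau, Equiv.swap_apply_def]
  simp only [posL, posR, Fin.lt_def, Fin.ext_iff] at *
  split_ifs <;> simp <;> omega

theorem card_invSet_of_desc {i : Fin (n - 1)} {x : Equiv.Perm (Fin n)} (h : Desc i x) :
    (invSet x).card = (invSet (tau i * x)).card + 1 := by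
  have hmem : (posL i, posR i) ∈ invSet x := by simp [invSet, posL_lt_posR]; exact h
  have htt : ∀ a, tau i (tau i a) = a := fun a => by
    rw [← Equiv.Perm.mul_apply, tau_mul_self]; rfl
  rw [← Finset.card_erase_add_one hmem]
  congr 1
  refine Finset.card_nbij' (fun p => (tau i p.1, tau i p.2)) (fun p => (tau i p.1, tau i p.2))
    ?_ ?_ ?_ ?_
  · rintro ⟨a, b⟩ hab
    simp only [invSet, Finset.coe_erase, Finset.coe_filter, Finset.mem_univ, true_and,
      Set.mem_sdiff, Set.mem_ofPred_eq, Set.mem_singleton_iff, Prod.mk.injEq] at hab ⊢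
    refine ⟨tau_lt_tau i a b hab.1.1 hab.2, ?_⟩
    simp only [tau_mul_symm_apply, htt]
    exact hab.1.2
  · rintro ⟨a, b⟩ hab
    simp only [invSet, Finset.coe_erase, Finset.coe_filter, Finset.mem_univ, true_and,
      Set.mem_sdiff, Set.mem_ofPred_eq, Set.mem_singleton_iff, Prod.mk.injEq,
      tau_mul_symm_apply] at hab ⊢
    have hne : ¬ (a = posL i ∧ b = posR i) := by
      rintro ⟨rfl, rfl⟩
      have := hab.2
      simp only [tau_posL, tau_posR] at this
      exact absurd this (not_lt.2 h.le)
    refine ⟨⟨tau_lt_tau i a b hab.1 hne, hab.2⟩, ?_⟩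
    rintro ⟨h1, h2⟩
    have h1' := congrArg (tau i) h1
    have h2' := congrArg (tau i) h2
    rw [htt, tau_posL] at h1'
    rw [htt, tau_posR] at h2'
    subst h1' h2'
    exact absurd hab.1 (not_lt.2 (posL_lt_posR i).le)
  · rintro ⟨a, b⟩ _; simp [htt]
  · rintro ⟨a, b⟩ _; simp [htt]

theorem desc_tau_mul {i : Fin (n - 1)} {x : Equiv.Perm (Fin n)} (h : ¬ Desc i x) :
    Desc i (tau i * x) := by
  simp only [Desc, tau_mul_symm_apply, tau_posL, tau_posR, not_lt] at h ⊢
  exact lt_of_le_of_ne h fun e => (posL_lt_posR i).ne (x.symm.injective e)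

theorem card_invSet_tau_mul_le (i : Fin (n - 1)) (x : Equiv.Perm (Fin n)) :
    (invSet (tau i * x)).card ≤ (invSet x).card + 1 := by
  by_cases h : Desc i x
  · have := card_invSet_of_desc h; omega
  · have := card_invSet_of_desc (desc_tau_mul h)
    rw [tau_mul_tau_mul] at this; omega

theorem card_invSet_one : (invSet (1 : Equiv.Perm (Fin n))).card = 0 := by
  rw [Finset.card_eq_zero]
  ext ⟨a, b⟩
  simp only [invSet, Finset.mem_filter, Finset.mem_univ, true_and, Finset.notMem_empty, iff_false,
    not_and, not_lt]
  exact fun h => h.le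

theorem card_invSet_le_length (l : List (Fin (n - 1))) :
    (invSet (l.map tau).prod).card ≤ l.length := by
  induction l with
  | nil => simp [card_invSet_one]
  | cons i t ih =>
    simp only [List.map_cons, List.prod_cons, List.length_cons]
    exact (card_invSet_tau_mul_le i _).trans (by omega)

theorem eq_one_of_no_desc (x : Equiv.Perm (Fin n)) (h : ∀ i, ¬ Desc i x) : x = 1 := by
  have hm : StrictMono x.symm := by
    rcases n with _ | m
    · intro a; exact a.elim0
    · rw [Fin.strictMono_iff_lt_succ]
      intro i
      have := h i
      simp only [Desc, not_lt] at this
      refine lt_of_le_of_ne this fun e => ?_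
      have := x.symm.injective e
      simp [Fin.ext_iff] at this
  have : (⇑x.symm) = id := by
    have e := Subsingleton.elim (hm.orderIsoOfSurjective _ x.symm.surjective) (OrderIso.refl _)
    funext a
    exact congrArg (fun f : Fin n ≃o Fin n => f a) e
  ext a
  have h2 := congrFun this (x a)
  simp only [Equiv.symm_apply_apply, id] at h2
  rw [← h2]; rfl

theorem exists_word_length (x : Equiv.Perm (Fin n)) :
    ∃ l : List (Fin (n - 1)), (l.map tau).prod = x ∧ l.length = (invSet x).card := by
  induction hN : (invSet x).card generalizing x with
  | zero =>
    refine ⟨[], ?_, rfl⟩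
    refine (eq_one_of_no_desc x fun i hi => ?_).symm
    have := card_invSet_of_desc hi; omega
  | succ N ih =>
    by_cases h : ∃ i, Desc i x
    · obtain ⟨i, hi⟩ := h
      have hc := card_invSet_of_desc hi
      obtain ⟨l, hl, hlen⟩ := ih (tau i * x) (by omega)
      exact ⟨i :: l, by simp [hl, tau_mul_tau_mul], by simp [hlen]⟩
    · rw [eq_one_of_no_desc x (by simpa using h), card_invSet_one] at hN
      omega

theorem isReducedWord_iff (l : List (Fin (n - 1))) (x : Equiv.Perm (Fin n)) :
    IsReducedWord l x ↔ (l.map tau).prod = x ∧ l.length = (invSet x).card := by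
  constructor
  · rintro ⟨h, hmin⟩
    obtain ⟨l', h', hl'⟩ := exists_word_length x
    refine ⟨h, le_antisymm (hl' ▸ hmin l' h') ?_⟩
    rw [← h]; exact card_invSet_le_length l
  · rintro ⟨h, hlen⟩
    refine ⟨h, fun l' h' => ?_⟩
    rw [hlen, ← h']; exact card_invSet_le_length l'

theorem exists_isReducedWord (x : Equiv.Perm (Fin n)) : ∃ l, IsReducedWord l x := by
  obtain ⟨l, hl⟩ := exists_word_length x
  exact ⟨l, (isReducedWord_iff l x).2 hl⟩

theorem IsReducedWord.cons {i : Fin (n - 1)} {x : Equiv.Perm (Fin n)} (h : Desc i x)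
    {l : List (Fin (n - 1))} (hl : IsReducedWord l (tau i * x)) : IsReducedWord (i :: l) x := by
  rw [isReducedWord_iff] at hl ⊢
  have := card_invSet_of_desc h
  exact ⟨by simp [hl.1, tau_mul_tau_mul], by simp [hl.2]; omega⟩

theorem IsReducedWord.of_cons {i : Fin (n - 1)} {x : Equiv.Perm (Fin n)}
    {l : List (Fin (n - 1))} (hl : IsReducedWord (i :: l) x) :
    Desc i x ∧ IsReducedWord l (tau i * x) := by
  rw [isReducedWord_iff] at hl
  obtain ⟨h1, h2⟩ := hl
  simp only [List.map_cons, List.prod_cons, List.length_cons] at h1 h2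
  have h3 : (l.map tau).prod = tau i * x := by rw [← h1, tau_mul_tau_mul]
  have h4 := card_invSet_le_length l
  rw [h3] at h4
  have hd : Desc i x := by
    by_contra h
    have := card_invSet_of_desc (desc_tau_mul h)
    rw [tau_mul_tau_mul] at this; omega
  refine ⟨hd, (isReducedWord_iff _ _).2 ⟨h3, ?_⟩⟩
  have := card_invSet_of_desc hd; omega

theorem desc_far {i j : Fin (n - 1)} (hij : (i : ℕ) + 1 < j ∨ (j : ℕ) + 1 < i)
    {x : Equiv.Perm (Fin n)} (hj : Desc j x) : Desc j (tau i * x) := by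
  simp only [Desc, tau_mul_symm_apply] at hj ⊢
  rw [tau_of_ne i (posR j) (by simp [posR]; omega) (by simp [posR]; omega),
    tau_of_ne i (posL j) (by simp [posL]; omega) (by simp [posL]; omega)]
  exact hj

theorem tau_far (i j : Fin (n - 1)) (h : (i : ℕ) + 1 < j) : tau i * tau j = tau j * tau i := by
  have h1 : posL i ≠ posL j := by simp [posL, Fin.ext_iff]; omega
  have h2 : posL i ≠ posR j := by simp [posL, posR, Fin.ext_iff]; omega
  have h3 : posR i ≠ posL j := by simp [posL, posR, Fin.ext_iff]; omega
  have h4 : posR i ≠ posR j := by simp [posR, Fin.ext_iff]; omega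
  exact (Equiv.Perm.disjoint_swap_swap (by
    simp [(posL_lt_posR i).ne, (posL_lt_posR j).ne, h1, h2, h3, h4])).commute

theorem tau_near (i j : Fin (n - 1)) (h : (i : ℕ) + 1 = j) :
    tau i * tau j * tau i = tau j * tau i * tau j := by
  have e : posL j = posR i := by simp [posL, posR, Fin.ext_iff]; omega
  have h1 : posL i ≠ posR j := by simp [posL, posR, Fin.ext_iff]; omega
  have h2 := (posL_lt_posR i).ne
  have h3 := (posL_lt_posR j).ne
  rw [e] at h3
  simp only [tau, e]
  rw [Equiv.swap_mul_swap_mul_swap h2 h1, Equiv.swap_comm (posR i) (posR j),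
    Equiv.swap_comm (posL i) (posR i), Equiv.swap_mul_swap_mul_swap h3.symm h1.symm]
  exact Equiv.swap_comm _ _

theorem desc_near {i j : Fin (n - 1)} (hij : (i : ℕ) + 1 = j ∨ (j : ℕ) + 1 = i)
    {x : Equiv.Perm (Fin n)} (hi : Desc i x) (hj : Desc j x) :
    Desc j (tau i * x) ∧ Desc i (tau j * (tau i * x)) := by
  simp only [Desc, tau_mul_symm_apply] at hi hj ⊢
  rcases hij with h | h
  · have e : posL j = posR i := by simp [posL, posR, Fin.ext_iff]; omega
    have e1 : tau i (posR j) = posR j := tau_of_ne _ _ (by simp [posR]; omega) (by simp [posR]; omega)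
    have e2 : tau j (posL i) = posL i := tau_of_ne _ _ (by simp [posL]; omega) (by simp [posL]; omega)
    have e3 : tau j (posR i) = posR j := by rw [← e, tau_posL]
    rw [e2, e3, e1, e, tau_posL, tau_posR]
    rw [e] at hj
    exact ⟨hj.trans hi, hj⟩
  · have e : posR j = posL i := by simp [posL, posR, Fin.ext_iff]; omega
    have e1 : tau i (posL j) = posL j := tau_of_ne _ _ (by simp [posL]; omega) (by simp [posL]; omega)
    have e2 : tau j (posR i) = posR i := tau_of_ne _ _ (by simp [posR]; omega) (by simp [posR]; omega)
    have e3 : tau j (posL i) = posL j := by rw [← e, tau_posR]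
    rw [e2, e3, e1, e, tau_posL, tau_posR]
    rw [e] at hj
    exact ⟨hi.trans hj, hj⟩

/-- All reduced words of a permutation have the same image in the braid group. -/
theorem IsReducedWord.sigma_prod_eq {x : Equiv.Perm (Fin n)} {l l' : List (Fin (n - 1))}
    (hl : IsReducedWord l x) (hl' : IsReducedWord l' x) :
    (l.map sigma).prod = (l'.map sigma).prod := by
  induction hN : l.length using Nat.strong_induction_on generalizing x l l' with
  | _ N ih =>
  have hlen : l'.length = l.length := by
    rw [isReducedWord_iff] at hl hl'; rw [hl.2, hl'.2]
  rcases l with _ | ⟨i, t⟩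
  · rw [List.length_nil, List.length_eq_zero_iff] at hlen
    rw [hlen]
  rcases l' with _ | ⟨j, t'⟩
  · simp at hlen
  obtain ⟨hi, ht⟩ := hl.of_cons
  obtain ⟨hj, ht'⟩ := hl'.of_cons
  simp only [List.length_cons] at hN hlen
  have IH : ∀ {y : Equiv.Perm (Fin n)} {m m' : List (Fin (n - 1))}, m.length < N →
      IsReducedWord m y → IsReducedWord m' y → (m.map sigma).prod = (m'.map sigma).prod :=
    fun hm h h' => ih _ hm h h' rfl
  simp only [List.map_cons, List.prod_cons]
  have far : ∀ i j : Fin (n - 1), ((i : ℕ) + 1 < j ∨ (j : ℕ) + 1 < i) →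
      tau i * tau j = tau j * tau i ∧ sigma i * sigma j = sigma j * sigma i := by
    rintro i j (h | h)
    · exact ⟨tau_far i j h, sigma_far i j h⟩
    · exact ⟨(tau_far j i h).symm, (sigma_far j i h).symm⟩
  have near : ∀ i j : Fin (n - 1), ((i : ℕ) + 1 = j ∨ (j : ℕ) + 1 = i) →
      tau i * tau j * tau i = tau j * tau i * tau j ∧
      sigma i * sigma j * sigma i = sigma j * sigma i * sigma j := by
    rintro i j (h | h)
    · exact ⟨tau_near i j h, sigma_near i j h⟩
    · exact ⟨(tau_near j i h).symm, (sigma_near j i h).symm⟩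
  by_cases hij : i = j
  · subst hij
    rw [IH (by omega) ht ht']
  by_cases hf : (i : ℕ) + 1 < j ∨ (j : ℕ) + 1 < i
  · obtain ⟨et, es⟩ := far i j hf
    obtain ⟨m, hm⟩ := exists_isReducedWord (tau j * (tau i * x))
    have h1 : IsReducedWord (j :: m) (tau i * x) := hm.cons (desc_far hf hj)
    have h2 : IsReducedWord (i :: m) (tau j * x) :=
      IsReducedWord.cons (desc_far hf.symm hi) (by rwa [← mul_assoc, et, mul_assoc])
    rw [IH (by omega) ht h1, IH (by omega) ht' h2]
    simp only [List.map_cons, List.prod_cons, ← mul_assoc, es]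
  · have hn : (i : ℕ) + 1 = j ∨ (j : ℕ) + 1 = i := by
      have : (i : ℕ) ≠ j := fun h => hij (Fin.ext h)
      omega
    obtain ⟨et, es⟩ := near i j hn
    obtain ⟨m, hm⟩ := exists_isReducedWord (tau i * (tau j * (tau i * x)))
    have h1 : IsReducedWord (j :: i :: m) (tau i * x) :=
      (hm.cons (desc_near hn hi hj).2).cons (desc_near hn hi hj).1
    have h2 : IsReducedWord (i :: j :: m) (tau j * x) := by
      refine IsReducedWord.cons (desc_near hn.symm hj hi).1
        (IsReducedWord.cons (desc_near hn.symm hj hi).2 ?_)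
      simpa only [← mul_assoc, et] using hm
    rw [IH (by omega) ht h1, IH (by omega) ht' h2]
    simp only [List.map_cons, List.prod_cons, ← mul_assoc, es]

/-- The section `s : S_n → B_n`, sending `τ_{i₁} ⋯ τ_{i_j}` to `σ_{i₁} ⋯ σ_{i_j}` for every
word of minimal length. -/
noncomputable def braidSection (x : Equiv.Perm (Fin n)) : BraidGroup n :=
  ((exists_isReducedWord x).choose.map sigma).prod

/-- The value of the section does not depend on the reduced word. -/
theorem braidSection_eq {x : Equiv.Perm (Fin n)} {l : List (Fin (n - 1))}
    (hl : IsReducedWord l x) : braidSection x = (l.map sigma).prod :=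
  (exists_isReducedWord x).choose_spec.sigma_prod_eq hl

theorem braidSection_one : braidSection (1 : Equiv.Perm (Fin n)) = 1 :=
  braidSection_eq (l := []) ⟨rfl, fun _ _ => Nat.zero_le _⟩

theorem braidSection_desc {i : Fin (n - 1)} {x : Equiv.Perm (Fin n)} (h : Desc i x) :
    braidSection x = sigma i * braidSection (tau i * x) := by
  obtain ⟨l, hl⟩ := exists_isReducedWord (tau i * x)
  rw [braidSection_eq hl, braidSection_eq (hl.cons h), List.map_cons, List.prod_cons]

theorem tau_inv (i : Fin (n - 1)) : (tau i)⁻¹ = tau i := Equiv.swap_inv _ _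

theorem IsReducedWord.reverse {l : List (Fin (n - 1))} {x : Equiv.Perm (Fin n)}
    (hl : IsReducedWord l x) : IsReducedWord l.reverse x⁻¹ := by
  have key : ∀ m : List (Fin (n - 1)), (m.reverse.map tau).prod = ((m.map tau).prod)⁻¹ := by
    intro m
    rw [List.prod_inv_reverse, List.map_map, List.map_reverse]
    congr 2
  refine ⟨by rw [key, hl.1], fun l' h' => ?_⟩
  have := hl.2 l'.reverse (by rw [key, h', inv_inv])
  simpa using this

/-- Recursion for the section along a right descent. -/
theorem braidSection_desc_right {i : Fin (n - 1)} {x : Equiv.Perm (Fin n)} (h : Desc i x⁻¹) :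
    braidSection x = braidSection (x * tau i) * sigma i := by
  obtain ⟨l, hl⟩ := exists_isReducedWord (tau i * x⁻¹)
  have h1 := (hl.cons h).reverse
  have h2 := hl.reverse
  rw [inv_inv] at h1
  rw [mul_inv_rev, inv_inv, tau_inv] at h2
  rw [braidSection_eq h1, braidSection_eq h2]
  simp

/-! ### Shuffles -/

/-- The set `X_{p,q}` of `(p,q)`-shuffles: `x⁻¹` is increasing on the first `p` and on the
last `q` positions. -/
def shuffleX (p q : ℕ) : Set (Equiv.Perm (Fin (p + q))) :=
  {x | (∀ a b : Fin p, a < b → x⁻¹ (Fin.castAdd q a) < x⁻¹ (Fin.castAdd q b)) ∧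
    ∀ a b : Fin q, a < b → x⁻¹ (Fin.natAdd p a) < x⁻¹ (Fin.natAdd p b)}

/-- The set `Y_{p,q}` of inverses of `(p,q)`-shuffles. -/
def shuffleY (p q : ℕ) : Set (Equiv.Perm (Fin (p + q))) := {x | x⁻¹ ∈ shuffleX p q}

/-- The permutation acting by `a` on the first `p` and by `b` on the last `q` positions. -/
def blockPerm {p q : ℕ} (a : Equiv.Perm (Fin p)) (b : Equiv.Perm (Fin q)) :
    Equiv.Perm (Fin (p + q)) :=
  finSumFinEquiv.permCongr (Equiv.sumCongr a b)

section Shuffle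

variable {p q : ℕ}

@[simp] theorem blockPerm_castAdd (a : Equiv.Perm (Fin p)) (b : Equiv.Perm (Fin q)) (i : Fin p) :
    blockPerm a b (Fin.castAdd q i) = Fin.castAdd q (a i) := by
  simp [blockPerm, Equiv.permCongr_apply]

@[simp] theorem blockPerm_natAdd (a : Equiv.Perm (Fin p)) (b : Equiv.Perm (Fin q)) (i : Fin q) :
    blockPerm a b (Fin.natAdd p i) = Fin.natAdd p (b i) := by
  simp [blockPerm, Equiv.permCongr_apply]

theorem blockPerm_ext {x y : Equiv.Perm (Fin (p + q))}
    (h₁ : ∀ i, x (Fin.castAdd q i) = y (Fin.castAdd q i))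
    (h₂ : ∀ i, x (Fin.natAdd p i) = y (Fin.natAdd p i)) : x = y := by
  ext i
  refine Fin.addCases (fun i => ?_) (fun i => ?_) i
  · rw [h₁]
  · rw [h₂]

theorem blockPerm_mul (a a' : Equiv.Perm (Fin p)) (b b' : Equiv.Perm (Fin q)) :
    blockPerm a b * blockPerm a' b' = blockPerm (a * a') (b * b') :=
  blockPerm_ext (by simp) (by simp)

theorem blockPerm_one : blockPerm (1 : Equiv.Perm (Fin p)) (1 : Equiv.Perm (Fin q)) = 1 :=
  blockPerm_ext (by simp) (by simp)

theorem blockPerm_inv (a : Equiv.Perm (Fin p)) (b : Equiv.Perm (Fin q)) :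
    (blockPerm a b)⁻¹ = blockPerm a⁻¹ b⁻¹ := by
  rw [inv_eq_iff_mul_eq_one, blockPerm_mul]; simp [blockPerm_one]

/-- The index of `σ_i` acting on the first block. -/
def idxL (q : ℕ) (i : Fin (p - 1)) : Fin (p + q - 1) := ⟨i, by omega⟩

/-- The index of `σ_i` acting on the second block. -/
def idxR (p : ℕ) (i : Fin (q - 1)) : Fin (p + q - 1) := ⟨p + i, by omega⟩

theorem posL_idxL (i : Fin (p - 1)) : posL (idxL q i) = Fin.castAdd q (posL i) := rfl
theorem posR_idxL (i : Fin (p - 1)) : posR (idxL q i) = Fin.castAdd q (posR i) := rfl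
theorem posL_idxR (i : Fin (q - 1)) : posL (idxR p i) = Fin.natAdd p (posL i) := rfl
theorem posR_idxR (i : Fin (q - 1)) : posR (idxR p i) = Fin.natAdd p (posR i) := rfl

theorem tau_idxL (i : Fin (p - 1)) : tau (idxL q i) = blockPerm (tau i) 1 := by
  refine blockPerm_ext (fun a => ?_) (fun a => ?_)
  · rw [blockPerm_castAdd, tau, posL_idxL, posR_idxL, tau]
    exact (Fin.castAdd_injective p q).swap_apply _ _ _
  · rw [blockPerm_natAdd]
    refine tau_of_ne _ _ ?_ ?_ <;> simp [idxL] <;> omega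

theorem tau_idxR (i : Fin (q - 1)) : tau (idxR p i) = blockPerm 1 (tau i) := by
  refine blockPerm_ext (fun a => ?_) (fun a => ?_)
  · rw [blockPerm_castAdd]
    refine tau_of_ne _ _ ?_ ?_ <;> simp [idxR] <;> omega
  · rw [blockPerm_natAdd, tau, posL_idxR, posR_idxR, tau]
    exact (Fin.natAdd_injective q p).swap_apply _ _ _

theorem blockPerm_mul_symm (a : Equiv.Perm (Fin p)) (b : Equiv.Perm (Fin q))
    (x : Equiv.Perm (Fin (p + q))) (i : Fin (p + q)) :
    (blockPerm a b * x).symm i = x⁻¹ (blockPerm a⁻¹ b⁻¹ i) := by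
  rw [← blockPerm_inv, ← Equiv.Perm.mul_apply, ← mul_inv_rev]; rfl

theorem desc_blockPerm_left {a : Equiv.Perm (Fin p)} (b : Equiv.Perm (Fin q))
    {x : Equiv.Perm (Fin (p + q))} (hx : x ∈ shuffleX p q) {i : Fin (p - 1)} (h : Desc i a) :
    Desc (idxL q i) (blockPerm a b * x) := by
  rw [Desc, blockPerm_mul_symm, blockPerm_mul_symm, posL_idxL, posR_idxL, blockPerm_castAdd,
    blockPerm_castAdd]
  exact hx.1 _ _ h

theorem desc_blockPerm_right (a : Equiv.Perm (Fin p)) {b : Equiv.Perm (Fin q)}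
    {x : Equiv.Perm (Fin (p + q))} (hx : x ∈ shuffleX p q) {i : Fin (q - 1)} (h : Desc i b) :
    Desc (idxR p i) (blockPerm a b * x) := by
  rw [Desc, blockPerm_mul_symm, blockPerm_mul_symm, posL_idxR, posR_idxR, blockPerm_natAdd,
    blockPerm_natAdd]
  exact hx.2 _ _ h

theorem eq_one_of_monotone {m : ℕ} {N : ℕ} (f g : Fin m → Fin N) (hf : StrictMono f)
    (hg : StrictMono g) (a : Equiv.Perm (Fin m)) (h : ∀ i, f (a i) = g i) : a = 1 := by
  have hm : StrictMono a := fun i j hij => by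
    rw [← hf.lt_iff_lt, h, h]; exact hg hij
  have e := Subsingleton.elim (hm.orderIsoOfSurjective _ a.surjective) (OrderIso.refl _)
  ext i
  exact congrArg (fun f : Fin m ≃o Fin m => (f i : ℕ)) e

/-- Every permutation is uniquely a product of a block permutation and a shuffle. -/
theorem blockPerm_mul_bijective : Function.Bijective
    (fun t : (Equiv.Perm (Fin p) × Equiv.Perm (Fin q)) × shuffleX p q =>
      blockPerm t.1.1 t.1.2 * t.2.1) := by
  constructor
  · rintro ⟨⟨a, b⟩, x, hx⟩ ⟨⟨a', b'⟩, x', hx'⟩ h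
    simp only at h
    have h1 : x' = blockPerm (a'⁻¹ * a) (b'⁻¹ * b) * x := by
      rw [← blockPerm_mul, mul_assoc, h, ← blockPerm_inv, inv_mul_cancel_left]
    have h2 : ∀ i, x'⁻¹ i = x⁻¹ (blockPerm (a'⁻¹ * a)⁻¹ (b'⁻¹ * b)⁻¹ i) := by
      intro i
      rw [h1, mul_inv_rev, blockPerm_inv]; rfl
    have ha := eq_one_of_monotone (fun i => x⁻¹ (Fin.castAdd q i)) (fun i => x'⁻¹ (Fin.castAdd q i))
      (fun i j => hx.1 i j) (fun i j => hx'.1 i j) (a'⁻¹ * a)⁻¹ (fun i => by rw [h2]; simp)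
    have hb := eq_one_of_monotone (fun i => x⁻¹ (Fin.natAdd p i)) (fun i => x'⁻¹ (Fin.natAdd p i))
      (fun i j => hx.2 i j) (fun i j => hx'.2 i j) (b'⁻¹ * b)⁻¹ (fun i => by rw [h2]; simp)
    rw [inv_eq_one, inv_mul_eq_one] at ha hb
    subst ha hb
    simp only [inv_mul_cancel, blockPerm_one, one_mul] at h1
    subst h1
    rfl
  · intro w
    have inj : ∀ {m : ℕ} (f : Fin m → Fin (p + q)), Function.Injective f →
        StrictMono (f ∘ Tuple.sort f) := fun f hf =>
      (Tuple.monotone_sort f).strictMono_of_injective (hf.comp (Equiv.injective _))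
    let f : Fin p → Fin (p + q) := fun i => w⁻¹ (Fin.castAdd q i)
    let g : Fin q → Fin (p + q) := fun i => w⁻¹ (Fin.natAdd p i)
    have hf := inj f ((Equiv.injective _).comp (Fin.castAdd_injective p q))
    have hg := inj g ((Equiv.injective _).comp (Fin.natAdd_injective q p))
    refine ⟨⟨⟨Tuple.sort f, Tuple.sort g⟩, (blockPerm (Tuple.sort f) (Tuple.sort g))⁻¹ * w,
      ?_, ?_⟩, ?_⟩
    · intro i j hij
      rw [mul_inv_rev, inv_inv, Equiv.Perm.mul_apply, Equiv.Perm.mul_apply, blockPerm_castAdd,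
        blockPerm_castAdd]
      exact hf hij
    · intro i j hij
      rw [mul_inv_rev, inv_inv, Equiv.Perm.mul_apply, Equiv.Perm.mul_apply, blockPerm_natAdd,
        blockPerm_natAdd]
      exact hg hij
    · simp

end Shuffle

end Braid

/-! ## Braided vector spaces and the braid group action on tensor powers -/

section Action

variable {k V : Type*} [Field k] [AddCommGroup V] [Module k V]

/-- A braiding on a vector space `V`: an automorphism of `V ⊗ V` satisfying the braid equation
`(c ⊗ id)(id ⊗ c)(c ⊗ id) = (id ⊗ c)(c ⊗ id)(id ⊗ c)`. -/
structure Braiding (k V : Type*) [Field k] [AddCommGroup V] [Module k V] where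
  /-- The underlying automorphism. -/
  c : V ⊗[k] V ≃ₗ[k] V ⊗[k] V
  braid_eq : ∀ t : V ⊗[k] V ⊗[k] V,
    c.toLinearMap.rTensor V ((TensorProduct.assoc k V V V).symm (c.toLinearMap.lTensor V
      (TensorProduct.assoc k V V V (c.toLinearMap.rTensor V t)))) =
    (TensorProduct.assoc k V V V).symm (c.toLinearMap.lTensor V (TensorProduct.assoc k V V V
      (c.toLinearMap.rTensor V ((TensorProduct.assoc k V V V).symm (c.toLinearMap.lTensor V
        (TensorProduct.assoc k V V V t))))))

variable {n : ℕ}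

open Function in
/-- The tensor `v₀ ⊗ ⋯ ⊗ v_{n-1}` with the factors in the positions `i, i+1` replaced by a
tensor in `V ⊗ V`. -/
noncomputable def pairInsert (i : Fin (n - 1)) (v : Fin n → V) : V ⊗[k] V →ₗ[k] ⨂[k]^n V :=
  TensorProduct.lift (LinearMap.mk₂ k
    (fun x y => PiTensorProduct.tprod k (update (update v (posL i) x) (posR i) y))
    (fun x x' y => by
      simp only [update_comm (posL_lt_posR i).ne, MultilinearMap.map_update_add])
    (fun r x y => by
      simp only [update_comm (posL_lt_posR i).ne, MultilinearMap.map_update_smul])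
    (fun x y y' => by simp only [MultilinearMap.map_update_add])
    (fun r x y => by simp only [MultilinearMap.map_update_smul]))

open Function in
theorem pairInsert_tmul (i : Fin (n - 1)) (v : Fin n → V) (x y : V) :
    pairInsert i v (x ⊗ₜ[k] y) =
      PiTensorProduct.tprod k (update (update v (posL i) x) (posR i) y) := rfl

open Function in
theorem pairInsert_update_left (i : Fin (n - 1)) (v : Fin n → V) (x : V) :
    pairInsert (k := k) i (update v (posL i) x) = pairInsert i v := by
  ext a b
  simp [pairInsert_tmul]

open Function in
theorem pairInsert_update_right (i : Fin (n - 1)) (v : Fin n → V) (x : V) :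
    pairInsert (k := k) i (update v (posR i) x) = pairInsert i v := by
  ext a b
  simp [pairInsert_tmul, update_comm (posL_lt_posR i).ne]

open Function in
theorem pairInsert_update_of_ne (i : Fin (n - 1)) (v : Fin n → V) {m : Fin n} (h₁ : m ≠ posL i)
    (h₂ : m ≠ posR i) (x a b : V) :
    pairInsert (k := k) i (update v m x) (a ⊗ₜ b) =
      PiTensorProduct.tprod k (update (update (update v (posL i) a) (posR i) b) m x) := by
  rw [pairInsert_tmul, update_comm h₁, update_comm h₂]

open Function in
/-- The operator `id ⊗ ⋯ ⊗ f ⊗ ⋯ ⊗ id` on `V^{⊗ n}`, with `f` acting on the tensor factors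
`i, i+1`. -/
noncomputable def localOp (f : V ⊗[k] V →ₗ[k] V ⊗[k] V) (i : Fin (n - 1)) :
    ⨂[k]^n V →ₗ[k] ⨂[k]^n V :=
  PiTensorProduct.lift
    { toFun := fun v => pairInsert i v (f (v (posL i) ⊗ₜ[k] v (posR i)))
      map_update_add' := by
        intro inst v m x y
        have e : inst = instDecidableEqFin n := Subsingleton.elim _ _
        subst e
        have hne := (posL_lt_posR i).ne
        by_cases h₁ : m = posL i
        · subst h₁
          simp [pairInsert_update_left, update_of_ne hne.symm, TensorProduct.add_tmul]
        by_cases h₂ : m = posR i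
        · subst h₂
          simp [pairInsert_update_right, update_of_ne hne, TensorProduct.tmul_add]
        simp only [update_of_ne (Ne.symm h₁), update_of_ne (Ne.symm h₂), ← LinearMap.add_apply]
        congr 1
        ext a b
        simp only [TensorProduct.AlgebraTensorModule.curry_apply, LinearMap.restrictScalars_self,
          TensorProduct.curry_apply, LinearMap.add_apply, pairInsert_update_of_ne i v h₁ h₂,
          MultilinearMap.map_update_add]
      map_update_smul' := by
        intro inst v m r x
        have e : inst = instDecidableEqFin n := Subsingleton.elim _ _
        subst e
        have hne := (posL_lt_posR i).ne
        by_cases h₁ : m = posL i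
        · subst h₁
          simp [pairInsert_update_left, update_of_ne hne.symm, ← TensorProduct.smul_tmul']
        by_cases h₂ : m = posR i
        · subst h₂
          simp [pairInsert_update_right, update_of_ne hne]
        simp only [update_of_ne (Ne.symm h₁), update_of_ne (Ne.symm h₂), ← LinearMap.smul_apply]
        congr 1
        ext a b
        simp only [TensorProduct.AlgebraTensorModule.curry_apply, LinearMap.restrictScalars_self,
          TensorProduct.curry_apply, LinearMap.smul_apply, pairInsert_update_of_ne i v h₁ h₂,
          MultilinearMap.map_update_smul] }

theorem localOp_tprod (f : V ⊗[k] V →ₗ[k] V ⊗[k] V) (i : Fin (n - 1)) (v : Fin n → V) :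
    localOp f i (PiTensorProduct.tprod k v) = pairInsert i v (f (v (posL i) ⊗ₜ[k] v (posR i))) :=
  PiTensorProduct.lift.tprod v

theorem localOp_pairInsert (f : V ⊗[k] V →ₗ[k] V ⊗[k] V) (i : Fin (n - 1)) (v : Fin n → V)
    (t : V ⊗[k] V) : localOp f i (pairInsert i v t) = pairInsert i v (f t) := by
  induction t with
  | zero => simp
  | add x y hx hy => simp only [map_add, hx, hy]
  | tmul x y =>
    rw [pairInsert_tmul, localOp_tprod, pairInsert_update_right, pairInsert_update_left,
      Function.update_self, Function.update_of_ne (posL_lt_posR i).ne, Function.update_self]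

theorem localOp_comp (f g : V ⊗[k] V →ₗ[k] V ⊗[k] V) (i : Fin (n - 1)) (t : ⨂[k]^n V) :
    localOp f i (localOp g i t) = localOp (f ∘ₗ g) i t := by
  induction t using PiTensorProduct.induction_on with
  | smul_tprod r v => simp only [map_smul, localOp_tprod, localOp_pairInsert, LinearMap.comp_apply]
  | add x y hx hy => simp only [map_add, hx, hy]

theorem localOp_id (i : Fin (n - 1)) (t : ⨂[k]^n V) :
    localOp (LinearMap.id : V ⊗[k] V →ₗ[k] V ⊗[k] V) i t = t := by
  induction t using PiTensorProduct.induction_on with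
  | smul_tprod r v =>
    simp only [map_smul, localOp_tprod, LinearMap.id_apply, pairInsert_tmul]
    simp
  | add x y hx hy => simp only [map_add, hx, hy]

open Function in
/-- Insertion of two tensors of `V ⊗ V` at two disjoint pairs of neighbouring positions. -/
noncomputable def pairInsertTwo (i j : Fin (n - 1)) (h : (i : ℕ) + 1 < j) (v : Fin n → V) :
    V ⊗[k] V →ₗ[k] V ⊗[k] V →ₗ[k] ⨂[k]^n V :=
  have h1 : posL j ≠ posL i := by simp [posL, Fin.ext_iff]; omega
  have h2 : posR j ≠ posL i := by simp [posL, posR, Fin.ext_iff]; omega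
  have h3 : posL j ≠ posR i := by simp [posL, posR, Fin.ext_iff]; omega
  have h4 : posR j ≠ posR i := by simp [posR, Fin.ext_iff]; omega
  TensorProduct.lift (LinearMap.mk₂ k
    (fun x y => pairInsert i (update (update v (posL j) x) (posR j) y))
    (fun x x' y => by
      ext a b
      simp [update_comm (posL_lt_posR j).ne, pairInsert_update_of_ne _ _ h1 h3])
    (fun r x y => by
      ext a b
      simp [update_comm (posL_lt_posR j).ne, pairInsert_update_of_ne _ _ h1 h3])
    (fun x y y' => by
      ext a b
      simp [pairInsert_update_of_ne _ _ h2 h4])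
    (fun r x y => by
      ext a b
      simp [pairInsert_update_of_ne _ _ h2 h4]))

open Function in
theorem pairInsertTwo_tmul (i j : Fin (n - 1)) (h : (i : ℕ) + 1 < j) (v : Fin n → V) (x y : V) :
    pairInsertTwo (k := k) i j h v (x ⊗ₜ y) =
      pairInsert i (update (update v (posL j) x) (posR j) y) := rfl

open Function in
theorem localOp_far (f : V ⊗[k] V →ₗ[k] V ⊗[k] V) (i j : Fin (n - 1)) (h : (i : ℕ) + 1 < j)
    (t : ⨂[k]^n V) : localOp f i (localOp f j t) = localOp f j (localOp f i t) := by
  have h1 : posL j ≠ posL i := by simp [posL, Fin.ext_iff]; omega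
  have h2 : posR j ≠ posL i := by simp [posL, posR, Fin.ext_iff]; omega
  have h3 : posL j ≠ posR i := by simp [posL, posR, Fin.ext_iff]; omega
  have h4 : posR j ≠ posR i := by simp [posR, Fin.ext_iff]; omega
  induction t using PiTensorProduct.induction_on with
  | add x y hx hy => simp only [map_add, hx, hy]
  | smul_tprod r v =>
    simp only [map_smul, localOp_tprod]
    congr 1
    have l1 : ∀ t, localOp f i (pairInsert j v t) =
        pairInsertTwo i j h v t (f (v (posL i) ⊗ₜ[k] v (posR i))) := by
      intro t
      induction t with
      | zero => simp
      | add x y hx hy => simp only [map_add, hx, hy, LinearMap.add_apply]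
      | tmul x y =>
        rw [pairInsert_tmul, localOp_tprod, pairInsertTwo_tmul, update_of_ne h2.symm,
          update_of_ne h1.symm, update_of_ne h4.symm, update_of_ne h3.symm]
    have l2 : ∀ (a b : V) (t : V ⊗[k] V), pairInsert j (update (update v (posL i) a) (posR i) b) t =
        pairInsertTwo i j h v t (a ⊗ₜ b) := by
      intro a b t
      induction t with
      | zero => simp
      | add x y hx hy => simp only [map_add, hx, hy, LinearMap.add_apply]
      | tmul x y =>
        rw [pairInsertTwo_tmul, pairInsert_update_of_ne _ _ h2 h4, pairInsert_tmul,
          update_comm h1, update_comm h3]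
    have l3 : ∀ s, localOp f j (pairInsert i v s) =
        pairInsertTwo i j h v (f (v (posL j) ⊗ₜ[k] v (posR j))) s := by
      intro s
      induction s with
      | zero => simp
      | add x y hx hy => simp only [map_add, hx, hy]
      | tmul x y =>
        rw [pairInsert_tmul, localOp_tprod, l2, update_of_ne h4, update_of_ne h2,
          update_of_ne h3, update_of_ne h1]
    rw [l1, l3]

open Function in
/-- Insertion of a tensor of `V ⊗ V ⊗ V` at three neighbouring positions. -/
noncomputable def tripInsert (i j : Fin (n - 1)) (h : (i : ℕ) + 1 = j) (v : Fin n → V) :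
    V ⊗[k] V ⊗[k] V →ₗ[k] ⨂[k]^n V :=
  have h1 : posR j ≠ posL i := by simp [posL, posR, Fin.ext_iff]; omega
  have h2 : posR j ≠ posR i := by simp [posR, Fin.ext_iff]; omega
  TensorProduct.lift (LinearMap.flip
    { toFun := fun z => pairInsert i (update v (posR j) z)
      map_add' := fun z z' => by
        ext a b
        simp [pairInsert_update_of_ne _ _ h1 h2]
      map_smul' := fun r z => by
        ext a b
        simp [pairInsert_update_of_ne _ _ h1 h2] })

open Function in
theorem tripInsert_tmul (i j : Fin (n - 1)) (h : (i : ℕ) + 1 = j) (v : Fin n → V)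
    (t : V ⊗[k] V) (z : V) :
    tripInsert (k := k) i j h v (t ⊗ₜ z) = pairInsert i (update v (posR j) z) t := rfl

open Function in
theorem localOp_tripInsert_left (f : V ⊗[k] V →ₗ[k] V ⊗[k] V) (i j : Fin (n - 1))
    (h : (i : ℕ) + 1 = j) (v : Fin n → V) (t : V ⊗[k] V ⊗[k] V) :
    localOp f i (tripInsert i j h v t) = tripInsert i j h v (f.rTensor V t) := by
  induction t with
  | zero => simp
  | add x y hx hy => simp only [map_add, hx, hy]
  | tmul x y => rw [LinearMap.rTensor_tmul, tripInsert_tmul, tripInsert_tmul, localOp_pairInsert]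

open Function in
theorem tripInsert_assoc_symm (i j : Fin (n - 1)) (h : (i : ℕ) + 1 = j) (v : Fin n → V)
    (x : V) (t : V ⊗[k] V) :
    tripInsert i j h v ((TensorProduct.assoc k V V V).symm (x ⊗ₜ t)) =
      pairInsert j (update v (posL i) x) t := by
  have e : posL j = posR i := by simp [posL, posR, Fin.ext_iff]; omega
  have h1 : posR j ≠ posL i := by simp [posL, posR, Fin.ext_iff]; omega
  have h2 : posR j ≠ posR i := by simp [posR, Fin.ext_iff]; omega
  induction t with
  | zero => simp
  | add x y hx hy => simp only [map_add, hx, hy, TensorProduct.tmul_add]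
  | tmul y z =>
    rw [TensorProduct.assoc_symm_tmul, tripInsert_tmul, pairInsert_update_of_ne _ _ h1 h2,
      pairInsert_tmul, e]

open Function in
theorem localOp_tripInsert_right (f : V ⊗[k] V →ₗ[k] V ⊗[k] V) (i j : Fin (n - 1))
    (h : (i : ℕ) + 1 = j) (v : Fin n → V) (t : V ⊗[k] V ⊗[k] V) :
    localOp f j (tripInsert i j h v t) = tripInsert i j h v ((TensorProduct.assoc k V V V).symm
      (f.lTensor V (TensorProduct.assoc k V V V t))) := by
  obtain ⟨t, rfl⟩ := (TensorProduct.assoc k V V V).symm.surjective t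
  rw [LinearEquiv.apply_symm_apply]
  induction t with
  | zero => simp
  | add x y hx hy => simp only [map_add, hx, hy]
  | tmul x t => rw [LinearMap.lTensor_tmul, tripInsert_assoc_symm, tripInsert_assoc_symm,
      localOp_pairInsert]

theorem Braiding.localOp_near (c : Braiding k V) (i j : Fin (n - 1)) (h : (i : ℕ) + 1 = j)
    (t : ⨂[k]^n V) :
    localOp c.c.toLinearMap i (localOp c.c.toLinearMap j (localOp c.c.toLinearMap i t)) =
    localOp c.c.toLinearMap j (localOp c.c.toLinearMap i (localOp c.c.toLinearMap j t)) := by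
  induction t using PiTensorProduct.induction_on with
  | add x y hx hy => simp only [map_add, hx, hy]
  | smul_tprod r v =>
    have e : PiTensorProduct.tprod k v =
        tripInsert i j h v (v (posL i) ⊗ₜ[k] v (posR i) ⊗ₜ[k] v (posR j)) := by
      rw [tripInsert_tmul, Function.update_eq_self, pairInsert_tmul, Function.update_eq_self,
        Function.update_eq_self]
    rw [e]
    simp only [map_smul, localOp_tripInsert_left, localOp_tripInsert_right]
    rw [c.braid_eq]

/-- The operator `σ_i` on `V^{⊗ n}` as an automorphism. -/
noncomputable def Braiding.localEquiv (c : Braiding k V) (n : ℕ) (i : Fin (n - 1)) :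
    ⨂[k]^n V ≃ₗ[k] ⨂[k]^n V :=
  LinearEquiv.ofLinearMap (localOp c.c.toLinearMap i) (localOp c.c.symm.toLinearMap i)
    (by ext1; ext v; simp [localOp_comp, localOp_id])
    (by ext1; ext v; simp [localOp_comp, localOp_id])

theorem Braiding.localEquiv_apply (c : Braiding k V) (n : ℕ) (i : Fin (n - 1)) (t : ⨂[k]^n V) :
    c.localEquiv n i t = localOp c.c.toLinearMap i t := rfl

/-- The action of the braid group on `V^{⊗ n}`, with `σ_i` acting as
`id ⊗ ⋯ ⊗ c ⊗ ⋯ ⊗ id` on the factors `i, i+1`. -/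
noncomputable def Braiding.action (c : Braiding k V) (n : ℕ) :
    BraidGroup n →* (⨂[k]^n V ≃ₗ[k] ⨂[k]^n V) :=
  PresentedGroup.toGroup (f := c.localEquiv n) (by
    rintro _ (⟨i, j, h⟩ | ⟨i, j, h⟩)
    · rw [map_mul, map_inv, mul_inv_eq_one]
      ext1 t
      simpa [Braiding.localEquiv_apply] using localOp_far _ i j h t
    · rw [map_mul, map_inv, mul_inv_eq_one]
      ext1 t
      simpa [Braiding.localEquiv_apply] using c.localOp_near i j h t)

theorem Braiding.action_sigma (c : Braiding k V) (i : Fin (n - 1)) (t : ⨂[k]^n V) :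
    c.action n (sigma i) t = localOp c.c.toLinearMap i t := by
  rw [Braiding.action, sigma, PresentedGroup.toGroup.of, Braiding.localEquiv_apply]

end Action

/-! ## The quantum symmetrizers -/

section Symmetrizer

variable {k V : Type*} [Field k] [AddCommGroup V] [Module k V] (c : Braiding k V)

open Classical in
/-- The operator `𝔖_X = ∑_{x ∈ X} s(x)` on `V^{⊗ n}`, for a set `X` of permutations. -/
noncomputable def Braiding.symOp {n : ℕ} (X : Set (Equiv.Perm (Fin n))) :
    ⨂[k]^n V →ₗ[k] ⨂[k]^n V :=
  ∑ x ∈ Finset.univ.filter (· ∈ X), (c.action n (braidSection x)).toLinearMap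

/-- The quantum symmetrizer `𝔖^n`, the sum over the whole symmetric group. -/
noncomputable def Braiding.sym (n : ℕ) : ⨂[k]^n V →ₗ[k] ⨂[k]^n V :=
  c.symOp (Set.univ : Set (Equiv.Perm (Fin n)))

/-- The component `Δ_{p,q} = 𝔖_{p,q}` of the comultiplication of the braided tensor algebra. -/
noncomputable def Braiding.comulPart (p q : ℕ) :
    ⨂[k]^(p + q) V →ₗ[k] ⨂[k]^p V ⊗[k] ⨂[k]^q V :=
  TensorPower.mulEquiv.symm.toLinearMap ∘ₗ c.symOp (shuffleX p q)

/-- The component `m_{p,q} = 𝔗_{p,q}` of the quantum shuffle multiplication. -/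
noncomputable def Braiding.shufflePart (p q : ℕ) :
    ⨂[k]^p V ⊗[k] ⨂[k]^q V →ₗ[k] ⨂[k]^(p + q) V :=
  c.symOp (shuffleY p q) ∘ₗ TensorPower.mulEquiv.toLinearMap

theorem Braiding.symOp_apply {n : ℕ} (X : Set (Equiv.Perm (Fin n))) [Fintype X] (t : ⨂[k]^n V) :
    c.symOp X t = ∑ x : X, c.action n (braidSection (x : Equiv.Perm (Fin n))) t := by
  classical
  rw [Braiding.symOp, LinearMap.sum_apply]
  exact (Finset.sum_subtype _ (by simp) _)

theorem Braiding.sym_apply (n : ℕ) (t : ⨂[k]^n V) :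
    c.sym n t = ∑ x : Equiv.Perm (Fin n), c.action n (braidSection x) t := by
  simp [Braiding.sym, Braiding.symOp, LinearMap.sum_apply]

variable {p q : ℕ}

theorem append_update_left {α : Type*} (v : Fin p → α) (w : Fin q → α) (i : Fin p) (x : α) :
    Fin.append (Function.update v i x) w = Function.update (Fin.append v w) (Fin.castAdd q i) x := by
  funext j
  refine Fin.addCases (fun j => ?_) (fun j => ?_) j
  · by_cases h : j = i
    · subst h; simp
    · simp [h, Function.update_of_ne]
  · rw [Function.update_of_ne] <;> simp [Fin.ext_iff]; omega

theorem append_update_right {α : Type*} (v : Fin p → α) (w : Fin q → α) (i : Fin q) (x : α) :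
    Fin.append v (Function.update w i x) = Function.update (Fin.append v w) (Fin.natAdd p i) x := by
  funext j
  refine Fin.addCases (fun j => ?_) (fun j => ?_) j
  · rw [Function.update_of_ne] <;> simp [Fin.ext_iff]; omega
  · by_cases h : j = i
    · subst h; simp
    · simp [h, Function.update_of_ne]

theorem mulEquiv_tprod (v : Fin p → V) (w : Fin q → V) :
    TensorPower.mulEquiv (PiTensorProduct.tprod k v ⊗ₜ[k] PiTensorProduct.tprod k w) =
      PiTensorProduct.tprod k (Fin.append v w) :=
  TensorPower.tprod_mul_tprod k v w

theorem localOp_mulEquiv_left (f : V ⊗[k] V →ₗ[k] V ⊗[k] V) (i : Fin (p - 1))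
    (a : ⨂[k]^p V) (b : ⨂[k]^q V) :
    localOp f (idxL q i) (TensorPower.mulEquiv (a ⊗ₜ[k] b)) =
      TensorPower.mulEquiv (localOp f i a ⊗ₜ[k] b) := by
  induction b using PiTensorProduct.induction_on with
  | add x y hx hy => simp only [map_add, TensorProduct.tmul_add, hx, hy]
  | smul_tprod r w =>
  induction a using PiTensorProduct.induction_on with
  | add x y hx hy => simp only [map_add, TensorProduct.add_tmul, hx, hy]
  | smul_tprod r' v =>
    simp only [TensorProduct.tmul_smul, ← TensorProduct.smul_tmul', map_smul, mulEquiv_tprod,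
      localOp_tprod, posL_idxL, posR_idxL, Fin.append_left]
    congr 2
    generalize f (v (posL i) ⊗ₜ[k] v (posR i)) = t
    induction t with
    | zero => simp
    | add x y hx hy => simp only [map_add, TensorProduct.add_tmul, hx, hy]
    | tmul x y =>
      rw [pairInsert_tmul, pairInsert_tmul, mulEquiv_tprod, append_update_left, append_update_left,
        posL_idxL, posR_idxL]

theorem localOp_mulEquiv_right (f : V ⊗[k] V →ₗ[k] V ⊗[k] V) (i : Fin (q - 1))
    (a : ⨂[k]^p V) (b : ⨂[k]^q V) :
    localOp f (idxR p i) (TensorPower.mulEquiv (a ⊗ₜ[k] b)) =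
      TensorPower.mulEquiv (a ⊗ₜ[k] localOp f i b) := by
  induction b using PiTensorProduct.induction_on with
  | add x y hx hy => simp only [map_add, TensorProduct.tmul_add, hx, hy]
  | smul_tprod r w =>
  induction a using PiTensorProduct.induction_on with
  | add x y hx hy => simp only [map_add, TensorProduct.add_tmul, hx, hy]
  | smul_tprod r' v =>
    simp only [TensorProduct.tmul_smul, ← TensorProduct.smul_tmul', map_smul, mulEquiv_tprod,
      localOp_tprod, posL_idxR, posR_idxR, Fin.append_right]
    congr 2
    generalize f (w (posL i) ⊗ₜ[k] w (posR i)) = t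
    induction t with
    | zero => simp
    | add x y hx hy => simp only [map_add, TensorProduct.tmul_add, hx, hy]
    | tmul x y =>
      rw [pairInsert_tmul, pairInsert_tmul, mulEquiv_tprod, append_update_right,
        append_update_right, posL_idxR, posR_idxR]

/-- The action of a pair of permutations on `V^{⊗ p} ⊗ V^{⊗ q}`. -/
noncomputable def Braiding.blockOp (a : Equiv.Perm (Fin p)) (b : Equiv.Perm (Fin q)) :
    ⨂[k]^p V ⊗[k] ⨂[k]^q V →ₗ[k] ⨂[k]^p V ⊗[k] ⨂[k]^q V :=
  TensorProduct.map (c.action p (braidSection a)).toLinearMap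
    (c.action q (braidSection b)).toLinearMap

theorem card_invSet_mul_tau (a : Equiv.Perm (Fin p)) :
    (invSet a = ∅ → a = 1) ∧ (a ≠ 1 → ∃ i, Desc i a) := by
  have h : a ≠ 1 → ∃ i, Desc i a := fun h => by
    by_contra hn
    exact h (eq_one_of_no_desc a (by simpa using hn))
  refine ⟨fun he => ?_, h⟩
  by_contra hn
  obtain ⟨i, hi⟩ := h hn
  have := card_invSet_of_desc hi
  rw [he] at this; simp at this

theorem Braiding.action_blockPerm_mul (a : Equiv.Perm (Fin p)) (b : Equiv.Perm (Fin q))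
    {x : Equiv.Perm (Fin (p + q))} (hx : x ∈ shuffleX p q) (t : ⨂[k]^(p + q) V) :
    c.action (p + q) (braidSection (blockPerm a b * x)) t =
      TensorPower.mulEquiv (c.blockOp a b (TensorPower.mulEquiv.symm
        (c.action (p + q) (braidSection x) t))) := by
  induction hN : (invSet a).card + (invSet b).card using Nat.strong_induction_on
    generalizing a b with
  | _ N ih =>
  by_cases ha : a = 1
  · by_cases hb : b = 1
    · subst ha hb
      have : c.blockOp (1 : Equiv.Perm (Fin p)) (1 : Equiv.Perm (Fin q)) = LinearMap.id := by
        rw [Braiding.blockOp, braidSection_one, braidSection_one, map_one, map_one]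
        exact TensorProduct.map_id
      rw [this, blockPerm_one, one_mul]; simp
    · obtain ⟨i, hi⟩ := (card_invSet_mul_tau b).2 hb
      have hc := card_invSet_of_desc hi
      rw [braidSection_desc (desc_blockPerm_right a hx hi), map_mul, LinearEquiv.mul_apply,
        tau_idxR, ← mul_assoc, blockPerm_mul, one_mul, ih _ (by omega) _ _ rfl, c.action_sigma]
      generalize TensorPower.mulEquiv.symm (c.action (p + q) (braidSection x) t) = u
      induction u with
      | zero => simp
      | add x y hx hy => simp only [map_add, hx, hy]
      | tmul x y =>
        rw [Braiding.blockOp, Braiding.blockOp, TensorProduct.map_tmul, TensorProduct.map_tmul,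
          localOp_mulEquiv_right, ← c.action_sigma, braidSection_desc hi, map_mul]
        rfl
  · obtain ⟨i, hi⟩ := (card_invSet_mul_tau a).2 ha
    have hc := card_invSet_of_desc hi
    rw [braidSection_desc (desc_blockPerm_left b hx hi), map_mul, LinearEquiv.mul_apply,
      tau_idxL, ← mul_assoc, blockPerm_mul, one_mul, ih _ (by omega) _ _ rfl, c.action_sigma]
    generalize TensorPower.mulEquiv.symm (c.action (p + q) (braidSection x) t) = u
    induction u with
    | zero => simp
    | add x y hx hy => simp only [map_add, hx, hy]
    | tmul x y =>
      rw [Braiding.blockOp, Braiding.blockOp, TensorProduct.map_tmul, TensorProduct.map_tmul,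
        localOp_mulEquiv_left, ← c.action_sigma, braidSection_desc hi, map_mul]
      rfl

theorem card_invSet_inv (a : Equiv.Perm (Fin p)) : (invSet a⁻¹).card = (invSet a).card := by
  obtain ⟨l, hl⟩ := exists_isReducedWord a
  have h1 := ((isReducedWord_iff _ _).1 hl).2
  have h2 := ((isReducedWord_iff _ _).1 hl.reverse).2
  rw [← h1, ← h2, List.length_reverse]

theorem Braiding.action_mul_blockPerm (a : Equiv.Perm (Fin p)) (b : Equiv.Perm (Fin q))
    {y : Equiv.Perm (Fin (p + q))} (hy : y ∈ shuffleY p q) (u : ⨂[k]^p V ⊗[k] ⨂[k]^q V) :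
    c.action (p + q) (braidSection (y * blockPerm a b)) (TensorPower.mulEquiv u) =
      c.action (p + q) (braidSection y) (TensorPower.mulEquiv (c.blockOp a b u)) := by
  induction hN : (invSet a⁻¹).card + (invSet b⁻¹).card using Nat.strong_induction_on
    generalizing a b u with
  | _ N ih =>
  have hinv : (y * blockPerm a b)⁻¹ = blockPerm a⁻¹ b⁻¹ * y⁻¹ := by
    rw [mul_inv_rev, blockPerm_inv]
  by_cases ha : a⁻¹ = 1
  · by_cases hb : b⁻¹ = 1
    · rw [inv_eq_one] at ha hb
      subst ha hb
      have : c.blockOp (1 : Equiv.Perm (Fin p)) (1 : Equiv.Perm (Fin q)) = LinearMap.id := by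
        rw [Braiding.blockOp, braidSection_one, braidSection_one, map_one, map_one]
        exact TensorProduct.map_id
      rw [this, blockPerm_one, mul_one]; simp
    · obtain ⟨i, hi⟩ := (card_invSet_mul_tau b⁻¹).2 hb
      have hc := card_invSet_of_desc hi
      have hd : Desc (idxR p i) (y * blockPerm a b)⁻¹ := by
        rw [hinv]; exact desc_blockPerm_right _ hy hi
      induction u with
      | zero => simp
      | add x y hx hy => simp only [map_add, hx, hy]
      | tmul x z =>
        rw [braidSection_desc_right hd, map_mul, LinearEquiv.mul_apply, c.action_sigma,
          localOp_mulEquiv_right, tau_idxR, mul_assoc, blockPerm_mul, mul_one,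
          ih _ (by rw [mul_inv_rev, tau_inv]; omega) _ _ _ rfl]
        rw [Braiding.blockOp, Braiding.blockOp, TensorProduct.map_tmul, TensorProduct.map_tmul,
          ← c.action_sigma, braidSection_desc_right hi, map_mul]
        rfl
  · obtain ⟨i, hi⟩ := (card_invSet_mul_tau a⁻¹).2 ha
    have hc := card_invSet_of_desc hi
    have hd : Desc (idxL q i) (y * blockPerm a b)⁻¹ := by
      rw [hinv]; exact desc_blockPerm_left _ hy hi
    induction u with
    | zero => simp
    | add x y hx hy => simp only [map_add, hx, hy]
    | tmul x z =>
      rw [braidSection_desc_right hd, map_mul, LinearEquiv.mul_apply, c.action_sigma,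
        localOp_mulEquiv_left, tau_idxL, mul_assoc, blockPerm_mul, mul_one,
        ih _ (by rw [mul_inv_rev, tau_inv]; omega) _ _ _ rfl]
      rw [Braiding.blockOp, Braiding.blockOp, TensorProduct.map_tmul, TensorProduct.map_tmul,
        ← c.action_sigma, braidSection_desc_right hi, map_mul]
      rfl

theorem Braiding.map_sym_sym (u : ⨂[k]^p V ⊗[k] ⨂[k]^q V) :
    TensorProduct.map (c.sym p) (c.sym q) u =
      ∑ ab : Equiv.Perm (Fin p) × Equiv.Perm (Fin q), c.blockOp ab.1 ab.2 u := by
  induction u with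
  | zero => simp
  | add x y hx hy => simp only [map_add, hx, hy, Finset.sum_add_distrib]
  | tmul x y =>
    rw [TensorProduct.map_tmul, c.sym_apply, c.sym_apply, TensorProduct.sum_tmul,
      Fintype.sum_prod_type]
    refine Finset.sum_congr rfl fun a _ => ?_
    rw [TensorProduct.tmul_sum]
    rfl

/-- `𝔖^{p+q} = (𝔖^p ⊗ 𝔖^q) 𝔖_{p,q}`. -/
theorem Braiding.sym_add (t : ⨂[k]^(p + q) V) :
    TensorPower.mulEquiv.symm (c.sym (p + q) t) =
      TensorProduct.map (c.sym p) (c.sym q) (c.comulPart p q t) := by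
  classical
  rw [LinearEquiv.symm_apply_eq, c.map_sym_sym, c.sym_apply,
    ← Function.Bijective.sum_comp blockPerm_mul_bijective, Fintype.sum_prod_type, map_sum]
  refine Finset.sum_congr rfl fun ab _ => ?_
  rw [Braiding.comulPart, LinearMap.comp_apply, c.symOp_apply]
  simp only [map_sum, LinearEquiv.coe_coe]
  exact Finset.sum_congr rfl fun x _ => c.action_blockPerm_mul _ _ x.2 t

/-- `𝔖^{p+q} = 𝔗_{p,q} (𝔖^p ⊗ 𝔖^q)`. -/
theorem Braiding.sym_mulEquiv (u : ⨂[k]^p V ⊗[k] ⨂[k]^q V) :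
    c.sym (p + q) (TensorPower.mulEquiv u) =
      c.shufflePart p q (TensorProduct.map (c.sym p) (c.sym q) u) := by
  classical
  have e : ∑ w : Equiv.Perm (Fin (p + q)), c.action (p + q) (braidSection w)
      (TensorPower.mulEquiv u) = ∑ w : Equiv.Perm (Fin (p + q)),
        c.action (p + q) (braidSection w⁻¹) (TensorPower.mulEquiv u) :=
    (Equiv.sum_comp (Equiv.inv _) _).symm
  rw [c.map_sym_sym, c.sym_apply, e,
    ← Function.Bijective.sum_comp blockPerm_mul_bijective, Fintype.sum_prod_type, map_sum,
    ← Equiv.sum_comp (Equiv.inv _)]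
  refine Finset.sum_congr rfl fun ab _ => ?_
  rw [Braiding.shufflePart, LinearMap.comp_apply, c.symOp_apply]
  let e' : shuffleX p q ≃ shuffleY p q := (Equiv.inv _).subtypeEquiv fun x => by
    simp [shuffleY]
  rw [← Equiv.sum_comp e']
  refine Finset.sum_congr rfl fun x _ => ?_
  have hx : (x : Equiv.Perm (Fin (p + q)))⁻¹ ∈ shuffleY p q := by simp [shuffleY]
  have := c.action_mul_blockPerm ab.1 ab.2 hx u
  refine Eq.trans ?_ this
  simp only [Equiv.inv_apply, Prod.fst_inv, Prod.snd_inv, mul_inv_rev, blockPerm_inv, inv_inv]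

end Symmetrizer

/-! ## The braided tensor algebra `A(V)`, the map `𝔖` and the algebra `𝔅(V)` -/

section TobaDef

variable {k V : Type*} [Field k] [AddCommGroup V] [Module k V]

/-- The tensor powers form a graded ring. -/
noncomputable instance tensorPowerGRing : DirectSum.GRing (fun n : ℕ => ⨂[k]^n V) :=
  { TensorPower.gsemiring with
    intCast := fun z => TensorPower.algebraMap₀ (z : k)
    intCast_ofNat := fun m => congrArg TensorPower.algebraMap₀ (Int.cast_natCast m)
    intCast_negSucc_ofNat := fun m => by
      rw [Int.cast_negSucc, map_neg]; rfl }

variable (k V) in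
/-- The tensor algebra `T(V) = ⨁ₙ V^{⊗ n}`, with its usual multiplication. It is the algebra
underlying the braided bialgebra `A(V)`. -/
abbrev TensorAlg : Type _ := ⨁ n : ℕ, ⨂[k]^n V

variable (k V) in
/-- The inclusion of `V^{⊗ n}` in the tensor algebra. -/
noncomputable abbrev incl (n : ℕ) : ⨂[k]^n V →ₗ[k] TensorAlg k V :=
  DirectSum.lof k ℕ (fun n => ⨂[k]^n V) n

variable (c : Braiding k V)

/-- The graded map `𝔖 = ⨁ₙ 𝔖^n`. -/
noncomputable def Braiding.symTotal : TensorAlg k V →ₗ[k] TensorAlg k V :=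
  DirectSum.lmap fun n => c.sym n

variable (k V) in
/-- The graded piece of degree `n` of the tensor algebra regarded in degree `m`: the identity for
`n = m` (and zero otherwise). -/
noncomputable def regrade (n m : ℕ) : ⨂[k]^n V →ₗ[k] ⨂[k]^m V :=
  DirectSum.component k ℕ (fun n => ⨂[k]^n V) m ∘ₗ incl k V n

/-- The comultiplication of `A(V)`, given on `V^{⊗ n}` by the sum over `p + q = n` of the
components `Δ_{p,q} = 𝔖_{p,q} : V^{⊗ n} → V^{⊗ p} ⊗ V^{⊗ q}`. -/
noncomputable def Braiding.comul : TensorAlg k V →ₗ[k] TensorAlg k V ⊗[k] TensorAlg k V :=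
  DirectSum.toModule k ℕ _ fun n => ∑ p ∈ Finset.HasAntidiagonal.antidiagonal n,
    TensorProduct.map (incl k V p.1) (incl k V p.2) ∘ₗ c.comulPart p.1 p.2 ∘ₗ
      regrade k V n (p.1 + p.2)

theorem regrade_self (n : ℕ) (t : ⨂[k]^n V) : regrade k V n n t = t := by
  simp [regrade]

variable (k V) in
/-- The deconcatenation comultiplication. -/
noncomputable def deconcat : TensorAlg k V →ₗ[k] TensorAlg k V ⊗[k] TensorAlg k V :=
  DirectSum.toModule k ℕ _ fun n => ∑ p ∈ Finset.HasAntidiagonal.antidiagonal n,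
    TensorProduct.map (incl k V p.1) (incl k V p.2) ∘ₗ TensorPower.mulEquiv.symm.toLinearMap ∘ₗ
      regrade k V n (p.1 + p.2)

theorem Braiding.symTotal_incl (n : ℕ) (t : ⨂[k]^n V) :
    c.symTotal (incl k V n t) = incl k V n (c.sym n t) := DirectSum.lmap_lof _ _ _

/-- `𝔖` is a morphism of coalgebras from `A(V)` to the deconcatenation coalgebra. -/
theorem Braiding.deconcat_symTotal (u : TensorAlg k V) :
    deconcat k V (c.symTotal u) = TensorProduct.map c.symTotal c.symTotal (c.comul u) := by
  induction u using DirectSum.induction_on with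
  | zero => simp
  | add x y hx hy => simp only [map_add, hx, hy]
  | of n t =>
    change deconcat k V (c.symTotal (incl k V n t)) =
      TensorProduct.map c.symTotal c.symTotal (c.comul (incl k V n t))
    rw [c.symTotal_incl, deconcat, Braiding.comul, DirectSum.toModule_lof, DirectSum.toModule_lof,
      LinearMap.sum_apply, LinearMap.sum_apply, map_sum]
    refine Finset.sum_congr rfl ?_
    rintro ⟨p, q⟩ hpq
    obtain rfl := Finset.HasAntidiagonal.mem_antidiagonal.1 hpq
    simp only [LinearMap.comp_apply, regrade_self, LinearEquiv.coe_coe, c.sym_add]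
    generalize c.comulPart p q t = w
    induction w with
    | zero => simp
    | add x y hx hy => simp only [map_add, hx, hy]
    | tmul x y => simp only [TensorProduct.map_tmul, c.symTotal_incl]

theorem incl_mul_incl (p q : ℕ) (a : ⨂[k]^p V) (b : ⨂[k]^q V) :
    incl k V p a * incl k V q b = incl k V (p + q) (TensorPower.mulEquiv (a ⊗ₜ[k] b)) :=
  DirectSum.of_mul_of _ _

/-- The quantum shuffle multiplication. -/
noncomputable def Braiding.shuffleMul :
    TensorAlg k V →ₗ[k] TensorAlg k V →ₗ[k] TensorAlg k V :=
  DirectSum.toModule k ℕ _ fun p => LinearMap.flip (DirectSum.toModule k ℕ _ fun q =>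
    LinearMap.flip (TensorProduct.curry (incl k V (p + q) ∘ₗ c.shufflePart p q)))

/-- `𝔖` is multiplicative from the tensor algebra to the quantum shuffle algebra. -/
theorem Braiding.symTotal_mul (u v : TensorAlg k V) :
    c.symTotal (u * v) = c.shuffleMul (c.symTotal u) (c.symTotal v) := by
  induction u using DirectSum.induction_on with
  | zero => simp
  | add x y hx hy => simp only [map_add, add_mul, hx, hy, LinearMap.add_apply]
  | of p a =>
  induction v using DirectSum.induction_on with
  | zero => simp
  | add x y hx hy => simp only [map_add, mul_add, hx, hy]
  | of q b =>
    change c.symTotal (incl k V p a * incl k V q b) =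
      c.shuffleMul (c.symTotal (incl k V p a)) (c.symTotal (incl k V q b))
    rw [incl_mul_incl, c.symTotal_incl, c.symTotal_incl, c.symTotal_incl, c.sym_mulEquiv,
      Braiding.shuffleMul, DirectSum.toModule_lof, LinearMap.flip_apply, DirectSum.toModule_lof]
    rfl

/-- The kernel of `𝔖`, a two-sided ideal of the tensor algebra. -/
noncomputable def Braiding.symKer : Ideal (TensorAlg k V) :=
  { LinearMap.ker c.symTotal with
    smul_mem' := fun x y hy => by
      have hy' : c.symTotal y = 0 := hy
      change c.symTotal (x * y) = 0
      rw [c.symTotal_mul, hy', map_zero] }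

theorem Braiding.mem_symKer (u : TensorAlg k V) : u ∈ c.symKer ↔ c.symTotal u = 0 := Iff.rfl

instance Braiding.symKer_isTwoSided : c.symKer.IsTwoSided :=
  ⟨fun {u} v hu => by
    rw [Braiding.mem_symKer] at hu ⊢
    rw [c.symTotal_mul, hu, map_zero, LinearMap.zero_apply]⟩

/-- The algebra `𝔅(V) = A(V) / ker 𝔖` of a braided vector space. -/
abbrev Braiding.Toba : Type _ := TensorAlg k V ⧸ c.symKer

/-- The projection `A(V) → 𝔅(V)`. -/
noncomputable def Braiding.proj : TensorAlg k V →ₐ[k] c.Toba := Ideal.Quotient.mkₐ k c.symKer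

theorem Braiding.proj_surjective : Function.Surjective c.proj := Ideal.Quotient.mk_surjective

theorem Braiding.proj_eq_zero_iff (u : TensorAlg k V) : c.proj u = 0 ↔ c.symTotal u = 0 :=
  Ideal.Quotient.eq_zero_iff_mem

/-- The component `𝔅^n(V)` of degree `n`. -/
noncomputable def Braiding.degree (n : ℕ) : Submodule k c.Toba :=
  LinearMap.range (c.proj.toLinearMap ∘ₗ incl k V n)

theorem exists_comp_eq_of_ker_le {M N P : Type*} [AddCommGroup M] [Module k M] [AddCommGroup N]
    [Module k N] [AddCommGroup P] [Module k P] (f : M →ₗ[k] N) (h : M →ₗ[k] P)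
    (hf : LinearMap.ker f ≤ LinearMap.ker h) : ∃ g : N →ₗ[k] P, g ∘ₗ f = h := by
  obtain ⟨r, hr⟩ := f.rangeRestrict.exists_rightInverse_of_surjective f.range_rangeRestrict
  obtain ⟨g, hg⟩ := (h ∘ₗ r).exists_extend
  refine ⟨g, LinearMap.ext fun u => ?_⟩
  have h1 : g (f u) = h (r (f.rangeRestrict u)) := LinearMap.congr_fun hg (f.rangeRestrict u)
  have h2 : f (r (f.rangeRestrict u)) = f u :=
    congrArg Subtype.val (LinearMap.congr_fun hr (f.rangeRestrict u))
  rw [LinearMap.comp_apply, h1, ← sub_eq_zero, ← map_sub]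
  exact hf (by rw [LinearMap.mem_ker, map_sub, h2, sub_self])

theorem Braiding.exists_proj_eq :
    ∃ g : TensorAlg k V →ₗ[k] c.Toba, g ∘ₗ c.symTotal = c.proj.toLinearMap :=
  exists_comp_eq_of_ker_le _ _ fun u hu => (c.proj_eq_zero_iff u).2 hu

/-- `ker 𝔖` is a coideal. -/
theorem Braiding.ker_proj_le :
    LinearMap.ker c.proj.toLinearMap ≤
      LinearMap.ker (TensorProduct.map c.proj.toLinearMap c.proj.toLinearMap ∘ₗ c.comul) := by
  intro u hu
  obtain ⟨g, hg⟩ := c.exists_proj_eq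
  have hu' : c.symTotal u = 0 := (c.proj_eq_zero_iff u).1 hu
  rw [LinearMap.mem_ker, LinearMap.comp_apply, ← hg, TensorProduct.map_comp, LinearMap.comp_apply,
    ← c.deconcat_symTotal, hu', map_zero, map_zero]

/-- The comultiplication of `𝔅(V)`, induced from the one of `A(V)`. -/
noncomputable def Braiding.tobaComul : c.Toba →ₗ[k] c.Toba ⊗[k] c.Toba :=
  (LinearMap.ker c.proj.toLinearMap).liftQ
      (TensorProduct.map c.proj.toLinearMap c.proj.toLinearMap ∘ₗ c.comul) c.ker_proj_le ∘ₗ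
    (c.proj.toLinearMap.quotKerEquivOfSurjective c.proj_surjective).symm.toLinearMap

theorem Braiding.tobaComul_proj (u : TensorAlg k V) :
    c.tobaComul (c.proj u) =
      TensorProduct.map c.proj.toLinearMap c.proj.toLinearMap (c.comul u) := by
  have : (c.proj.toLinearMap.quotKerEquivOfSurjective c.proj_surjective).symm (c.proj u) =
      (LinearMap.ker c.proj.toLinearMap).mkQ u := by
    rw [LinearEquiv.symm_apply_eq]; rfl
  rw [Braiding.tobaComul, LinearMap.comp_apply, LinearEquiv.coe_coe, this]
  rfl

end TobaDef

/-! ## Bilinear forms -/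

section Forms

variable {k V W : Type*} [Field k] [AddCommGroup V] [Module k V] [AddCommGroup W] [Module k W]

/-- The form `(x ⊗ x' | y ⊗ y') = (x | y) (x' | y')` on `V ⊗ V` and `W ⊗ W`. -/
noncomputable def tensorSquare (β : V →ₗ[k] W →ₗ[k] k) : V ⊗[k] V →ₗ[k] W ⊗[k] W →ₗ[k] k :=
  TensorProduct.dualDistrib k W W ∘ₗ TensorProduct.map β β

theorem tensorSquare_tmul (β : V →ₗ[k] W →ₗ[k] k) (x x' : V) (y y' : W) :
    tensorSquare β (x ⊗ₜ x') (y ⊗ₜ y') = β x y * β x' y' := rfl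

/-- Case (a): the braidings are adjoint for `(x ⊗ x' | y ⊗ y') = (x | y) (x' | y')`. -/
def CaseA (cV : Braiding k V) (cW : Braiding k W) (β : V →ₗ[k] W →ₗ[k] k) : Prop :=
  ∀ (x : V ⊗[k] V) (y : W ⊗[k] W), tensorSquare β (cV.c x) y = tensorSquare β x (cW.c y)

/-- Case (b): the braidings are adjoint for `(x ⊗ x' | y ⊗ y') = (x | y') (x' | y)`. -/
def CaseB (cV : Braiding k V) (cW : Braiding k W) (β : V →ₗ[k] W →ₗ[k] k) : Prop :=
  ∀ (x : V ⊗[k] V) (y : W ⊗[k] W),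
    tensorSquare β (cV.c x) (TensorProduct.comm k W W y) =
      tensorSquare β x (TensorProduct.comm k W W (cW.c y))

/-- The form `(v₁ ⊗ ⋯ ⊗ vₙ | w₁ ⊗ ⋯ ⊗ wₙ)_> = ∏ᵢ (vᵢ | wᵢ)`. -/
noncomputable def formGt (β : V →ₗ[k] W →ₗ[k] k) (n : ℕ) : ⨂[k]^n V →ₗ[k] ⨂[k]^n W →ₗ[k] k :=
  PiTensorProduct.dualDistrib ∘ₗ PiTensorProduct.map fun _ => β

theorem formGt_tprod (β : V →ₗ[k] W →ₗ[k] k) (n : ℕ) (v : Fin n → V) (w : Fin n → W) :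
    formGt β n (PiTensorProduct.tprod k v) (PiTensorProduct.tprod k w) = ∏ i, β (v i) (w i) := by
  simp [formGt]

/-- The form `(v₁ ⊗ ⋯ ⊗ vₙ | w₁ ⊗ ⋯ ⊗ wₙ)_< = ∏ᵢ (vᵢ | w_{n+1-i})`. -/
noncomputable def formLt (β : V →ₗ[k] W →ₗ[k] k) (n : ℕ) : ⨂[k]^n V →ₗ[k] ⨂[k]^n W →ₗ[k] k :=
  (formGt β n).compl₂ (PiTensorProduct.reindex k (fun _ => W) Fin.revPerm).toLinearMap

theorem formLt_tprod (β : V →ₗ[k] W →ₗ[k] k) (n : ℕ) (v : Fin n → V) (w : Fin n → W) :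
    formLt β n (PiTensorProduct.tprod k v) (PiTensorProduct.tprod k w) =
      ∏ i, β (v i) (w (Fin.rev i)) := by
  rw [formLt, LinearMap.compl₂_apply, LinearEquiv.coe_coe, PiTensorProduct.reindex_tprod,
    formGt_tprod]
  rfl

/-- The form `[u, z]` on `A(V) × A(W)` attached to forms `(|)` on the tensor powers: it is
`(𝔖ⁿ u | z)` for `u`, `z` of the same degree `n`, and zero for different degrees. -/
noncomputable def totalForm (cV : Braiding k V) (f : ∀ n : ℕ, ⨂[k]^n V →ₗ[k] ⨂[k]^n W →ₗ[k] k) :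
    TensorAlg k V →ₗ[k] TensorAlg k W →ₗ[k] k :=
  DirectSum.toModule k ℕ _ fun n =>
    (f n ∘ₗ cV.sym n).compl₂ (DirectSum.component k ℕ (fun n => ⨂[k]^n W) n)

theorem totalForm_same (cV : Braiding k V) (f : ∀ n : ℕ, ⨂[k]^n V →ₗ[k] ⨂[k]^n W →ₗ[k] k)
    (n : ℕ) (u : ⨂[k]^n V) (z : ⨂[k]^n W) :
    totalForm cV f (incl k V n u) (incl k W n z) = f n (cV.sym n u) z := by
  rw [totalForm, DirectSum.toModule_lof, LinearMap.compl₂_apply, DirectSum.component.lof_self]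
  rfl

theorem totalForm_of_ne (cV : Braiding k V) (f : ∀ n : ℕ, ⨂[k]^n V →ₗ[k] ⨂[k]^n W →ₗ[k] k)
    {m n : ℕ} (h : m ≠ n) (u : ⨂[k]^m V) (z : ⨂[k]^n W) :
    totalForm cV f (incl k V m u) (incl k W n z) = 0 := by
  rw [totalForm, DirectSum.toModule_lof, LinearMap.compl₂_apply, DirectSum.component.of,
    dif_neg h.symm, map_zero]

/-- The inclusion `V → 𝔅(V)` onto the component of degree one. -/
noncomputable def Braiding.deg1 (cV : Braiding k V) : V →ₗ[k] cV.Toba :=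
  cV.proj.toLinearMap ∘ₗ incl k V 1 ∘ₗ
    (PiTensorProduct.subsingletonEquiv (R := k) (s := fun _ : Fin 1 => V) 0).symm.toLinearMap

end Forms

/-! ## Pairings between `𝔅(V)` and `𝔅(W)` -/

section Pairing

variable {k V W : Type*} [Field k] [AddCommGroup V] [Module k V] [AddCommGroup W] [Module k W]

/-- The part of the requirements on a pairing `𝔅(V) ⊗ 𝔅(W) → k` that is common to both cases. -/
structure IsGradedPairing (cV : Braiding k V) (cW : Braiding k W) (β : V →ₗ[k] W →ₗ[k] k)
    (P : cV.Toba →ₗ[k] cW.Toba →ₗ[k] k) : Prop where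
  nondegenerate : P.Nondegenerate
  one_one : P 1 1 = 1
  graded : ∀ i j : ℕ, i ≠ j → ∀ x ∈ cV.degree i, ∀ y ∈ cW.degree j, P x y = 0
  deg_one : ∀ (v : V) (w : W), P (cV.deg1 v) (cW.deg1 w) = β v w

/-- The pairings in case (a): `[u, z z'] = [u₁, z] [u₂, z']` and `[u u', z] = [u, z₁] [u', z₂]`. -/
structure IsPairingA (cV : Braiding k V) (cW : Braiding k W) (β : V →ₗ[k] W →ₗ[k] k)
    (P : cV.Toba →ₗ[k] cW.Toba →ₗ[k] k) : Prop extends IsGradedPairing cV cW β P where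
  apply_mul : ∀ (u : cV.Toba) (z z' : cW.Toba),
    P u (z * z') = tensorSquare P (cV.tobaComul u) (z ⊗ₜ[k] z')
  mul_apply : ∀ (u u' : cV.Toba) (z : cW.Toba),
    P (u * u') z = tensorSquare P (u ⊗ₜ[k] u') (cW.tobaComul z)

/-- The pairings in case (b): `[u, z z'] = [u₁, z'] [u₂, z]` and `[u u', z] = [u, z₂] [u', z₁]`. -/
structure IsPairingB (cV : Braiding k V) (cW : Braiding k W) (β : V →ₗ[k] W →ₗ[k] k)
    (P : cV.Toba →ₗ[k] cW.Toba →ₗ[k] k) : Prop extends IsGradedPairing cV cW β P where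
  apply_mul : ∀ (u : cV.Toba) (z z' : cW.Toba),
    P u (z * z') = tensorSquare P (cV.tobaComul u) (z' ⊗ₜ[k] z)
  mul_apply : ∀ (u u' : cV.Toba) (z : cW.Toba),
    P (u * u') z = tensorSquare P (u' ⊗ₜ[k] u) (cW.tobaComul z)

end Pairing

end BraidedHopf

namespace BraidedHopf

/-! ### Tensor products of forms without radical -/

section Separating

variable {k V W V' W' : Type*} [Field k] [AddCommGroup V] [Module k V] [AddCommGroup W]
  [Module k W] [AddCommGroup V'] [Module k V'] [AddCommGroup W'] [Module k W']

/-! On `A(V) × A(W)` the form is `[u, z] = (𝔖 u | z)`, where `( | )` pairs tensor powers by products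
of values of `β`. Over a field, tensor products of forms without left radical have no left radical,
in any dimension. So `( | )` has none, and the left radical of `[ , ]` is exactly `ker 𝔖`
(`ker_totalForm`).

The right radical reduces to the left one because `𝔖` on `V` and `𝔖` on `W` are adjoint. The
hypothesis makes `σ_i` adjoint to `σ_i` in case (a). In case (b) it makes `σ_i` adjoint to the
generator with reversed index, since that form reverses the factors. Adjoints reverse words, so
`s(x)` is adjoint to `s(x⁻¹)`, respectively to `s((w x w⁻¹)⁻¹)` with `w` the order-reversing
permutation. Both substitutions permute the symmetric group and preserve reduced words, so the sums
over all `x` agree (`sym_adjoint`). Hence the flipped form is the form of the same kind for `W`, `V`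
and `β.flip` (`totalForm_flip`), and `[ , ]` descends to a nondegenerate pairing of the quotients.

For the product rules, `( | )` makes concatenation in `A(W)` adjoint to deconcatenation in `A(V)`,
with the two factors exchanged in case (b). The factorization `𝔖^{p+q} = (𝔖^p ⊗ 𝔖^q) 𝔖_{p,q}` says
that `𝔖` carries the comultiplication of `A(V)` to deconcatenation. Together these give `[u, z z'] =
(deconcat (𝔖 u) | z ⊗ z') = ((𝔖 ⊗ 𝔖) Δ u | z ⊗ z')`, which is the rule `apply_mul`. The rule
`mul_apply` is `apply_mul` for the flipped form.

Uniqueness holds because `𝔅(W)` is generated by its degree-one part. The normalizations fix a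
pairing when its second argument is `1` or of degree one, and `apply_mul` propagates the values to
products. Every pairing is therefore the one induced by `[ , ]`. -/

/-- In a basis of `V'` the tensor is a finite sum `∑ vᵢ ⊗ bᵢ`, and the coordinate functionals
recover the coefficients `vᵢ`. -/
theorem eq_zero_of_forall_lTensor (t : V ⊗[k] V')
    (h : ∀ φ : V' →ₗ[k] k, φ.lTensor V t = 0) : t = 0 := by
  classical
  let b := Module.Basis.ofVectorSpace k V'
  refine (TensorProduct.equivFinsuppOfBasisRight (M := V) b).injective ?_
  rw [map_zero]
  ext i
  have e : ∀ s : V ⊗[k] V', TensorProduct.equivFinsuppOfBasisRight b s i =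
      TensorProduct.rid k V ((b.coord i).lTensor V s) := by
    intro s
    induction s with
    | zero => simp
    | add x y hx hy => simp only [map_add, Finsupp.add_apply, hx, hy]
    | tmul x y => simp
  rw [e, h]
  simp

/-- The tensor product of two forms without left radical has no left radical. -/
theorem separatingLeft_tensor {B : V →ₗ[k] W →ₗ[k] k} {B' : V' →ₗ[k] W' →ₗ[k] k}
    (hB : B.SeparatingLeft) (hB' : B'.SeparatingLeft) (t : V ⊗[k] V')
    (h : ∀ (z : W) (z' : W'),
      TensorProduct.dualDistrib k W W' (TensorProduct.map B B' t) (z ⊗ₜ z') = 0) : t = 0 := by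
  have e : ∀ (s : V ⊗[k] V') (z : W) (z' : W'),
      TensorProduct.dualDistrib k W W' (TensorProduct.map B B' s) (z ⊗ₜ z') =
        B' (TensorProduct.lid k V' ((B.flip z).rTensor V' s)) z' := by
    intro s z z'
    induction s with
    | zero => simp
    | add x y hx hy => simp only [map_add, LinearMap.add_apply, hx, hy]
    | tmul x y => simp
  -- Contracting the first leg with `z` gives a vector of `V'` orthogonal to all of `W'`.
  have h1 : ∀ z, TensorProduct.lid k V' ((B.flip z).rTensor V' t) = 0 :=
    fun z => hB' _ fun z' => (e t z z').symm.trans (h z z')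
  -- Now the second leg is contracted with a functional `φ`, and the result in `V` is tested against
  -- `z`. Contractions of different legs commute, so this value is `φ` of the vector that vanishes
  -- by `h1`.
  refine eq_zero_of_forall_lTensor t fun φ => ?_
  refine (TensorProduct.rid k V).injective ?_
  rw [map_zero]
  refine hB _ fun z => ?_
  have e' : ∀ s : V ⊗[k] V', B (TensorProduct.rid k V (φ.lTensor V s)) z =
      φ (TensorProduct.lid k V' ((B.flip z).rTensor V' s)) := by
    intro s
    induction s with
    | zero => simp
    | add x y hx hy => simp only [map_add, LinearMap.add_apply, hx, hy]
    | tmul x y => simp [mul_comm]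
  rw [e', h1, map_zero]

end Separating

/-! ### The forms on tensor powers -/

section FormLemmas

variable {k V W : Type*} [Field k] [AddCommGroup V] [Module k V] [AddCommGroup W] [Module k W]
  (β : V →ₗ[k] W →ₗ[k] k)

theorem formGt_flip (n : ℕ) : (formGt β n).flip = formGt β.flip n := by
  ext w v
  change formGt β n (PiTensorProduct.tprod k v) (PiTensorProduct.tprod k w) =
    formGt β.flip n (PiTensorProduct.tprod k w) (PiTensorProduct.tprod k v)
  simp [formGt_tprod]

/-- Reversal is an involution, so substituting `rev i` for `i` in the product moves the reversal
from `w` to `v`. -/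
theorem formLt_flip (n : ℕ) : (formLt β n).flip = formLt β.flip n := by
  ext w v
  change formLt β n (PiTensorProduct.tprod k v) (PiTensorProduct.tprod k w) =
    formLt β.flip n (PiTensorProduct.tprod k w) (PiTensorProduct.tprod k v)
  rw [formLt_tprod, formLt_tprod, ← Equiv.prod_comp Fin.revPerm]
  refine Finset.prod_congr rfl fun i _ => ?_
  rw [Fin.revPerm_apply, Fin.rev_rev, LinearMap.flip_apply]

/-- The product over `Fin (p + q)` splits into its two blocks. Both the separation property, by
induction on the degree, and the product rule in case (a) rest on this. -/
theorem formGt_mulEquiv (p q : ℕ) (x : ⨂[k]^p V) (y : ⨂[k]^q V) (z : ⨂[k]^p W) (z' : ⨂[k]^q W) :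
    formGt β (p + q) (TensorPower.mulEquiv (x ⊗ₜ y)) (TensorPower.mulEquiv (z ⊗ₜ z')) =
      formGt β p x z * formGt β q y z' := by
  induction x using PiTensorProduct.induction_on with
  | add a b ha hb => simp only [TensorProduct.add_tmul, map_add, LinearMap.add_apply, ha, hb, add_mul]
  | smul_tprod r v =>
  induction y using PiTensorProduct.induction_on with
  | add a b ha hb => simp only [TensorProduct.tmul_add, map_add, LinearMap.add_apply, ha, hb, mul_add]
  | smul_tprod r' v' =>
  induction z using PiTensorProduct.induction_on with
  | add a b ha hb => simp only [TensorProduct.add_tmul, map_add, ha, hb, add_mul]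
  | smul_tprod s w =>
  induction z' using PiTensorProduct.induction_on with
  | add a b ha hb => simp only [TensorProduct.tmul_add, map_add, ha, hb, mul_add]
  | smul_tprod s' w' =>
    simp only [TensorProduct.tmul_smul, ← TensorProduct.smul_tmul', map_smul, LinearMap.smul_apply,
      mulEquiv_tprod, formGt_tprod, Fin.prod_univ_add, Fin.append_left, Fin.append_right,
      smul_eq_mul]
    ring

/-- Equal degrees such as `p + q` and `q + p` give different types of tensor powers. The
identification is made inside the direct sum. -/
theorem incl_tprod_cast {m n : ℕ} (h : m = n) (w : Fin n → W) :
    incl k W n (PiTensorProduct.tprod k w) =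
      incl k W m (PiTensorProduct.tprod k fun i => w (Fin.cast h i)) := by
  subst h; rfl

/-- Splitting off the last factor presents the form of degree `n + 1` as the tensor product of the
forms of degrees `n` and `1`, so `separatingLeft_tensor` gives the induction step. In degree one the
form is `β`, and in degree zero it is multiplication of scalars. -/
theorem formGt_separatingLeft (hβ : β.SeparatingLeft) (n : ℕ) : (formGt β n).SeparatingLeft := by
  induction n with
  | zero =>
    intro x hx
    obtain ⟨r, rfl⟩ := (PiTensorProduct.isEmptyEquiv (Fin 0)).symm.surjective x
    have := hx (PiTensorProduct.tprod k isEmptyElim)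
    rw [PiTensorProduct.isEmptyEquiv_symm_apply, map_smul, LinearMap.smul_apply, formGt_tprod] at this
    simp at this
    simp [this]
  | succ n ih =>
    intro x hx
    obtain ⟨t, rfl⟩ := (TensorPower.mulEquiv (n := n) (m := 1)).surjective x
    have h1 : (formGt β 1).SeparatingLeft := by
      intro x hx
      obtain ⟨v, rfl⟩ :=
        (PiTensorProduct.subsingletonEquiv (R := k) (s := fun _ : Fin 1 => V) 0).symm.surjective x
      have : v = 0 := hβ v fun w => by
        have := hx ((PiTensorProduct.subsingletonEquiv (R := k) (s := fun _ : Fin 1 => W) 0).symm w)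
        simpa only [PiTensorProduct.subsingletonEquiv_symm_apply, formGt_tprod, Fin.prod_univ_one,
          Function.update_self] using this
      rw [this, map_zero]
    rw [separatingLeft_tensor ih h1 t fun z z' => ?_, map_zero]
    rw [← hx (TensorPower.mulEquiv (z ⊗ₜ z'))]
    clear hx
    induction t with
    | zero => simp
    | add x y hx hy => simp only [map_add, LinearMap.add_apply, hx, hy]
    | tmul x y => rw [formGt_mulEquiv]; rfl

theorem formLt_separatingLeft (hβ : β.SeparatingLeft) (n : ℕ) : (formLt β n).SeparatingLeft := by
  intro x hx
  refine formGt_separatingLeft β hβ n x fun y => ?_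
  obtain ⟨y, rfl⟩ := (PiTensorProduct.reindex k (fun _ => W) (Fin.revPerm (n := n))).surjective y
  exact hx y

/-! ### Adjointness of the braid group actions -/

variable {n : ℕ}

/-- The positions other than `i, i+1` contribute a scalar independent of the inserted tensors. An
adjunction between operators on `V ⊗ V` and `W ⊗ W` thus passes to the local operators. -/
theorem formGt_pairInsert (i : Fin (n - 1)) (v : Fin n → V) (w : Fin n → W) (t : V ⊗[k] V)
    (s : W ⊗[k] W) :
    formGt β n (pairInsert i v t) (pairInsert i w s) =
      (∏ j ∈ {posL i, posR i}ᶜ, β (v j) (w j)) * tensorSquare β t s := by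
  classical
  induction t with
  | zero => simp
  | add x y hx hy => simp only [map_add, LinearMap.add_apply, hx, hy, mul_add]
  | tmul a b =>
  induction s with
  | zero => simp
  | add x y hx hy => simp only [map_add, hx, hy, mul_add]
  | tmul a' b' =>
    rw [pairInsert_tmul, pairInsert_tmul, formGt_tprod, tensorSquare_tmul,
      ← Finset.prod_compl_mul_prod {posL i, posR i}, Finset.prod_pair (posL_lt_posR i).ne]
    congr 1
    · refine Finset.prod_congr rfl fun j hj => ?_
      simp only [Finset.mem_compl, Finset.mem_insert, Finset.mem_singleton, not_or] at hj
      simp [Function.update_of_ne hj.1, Function.update_of_ne hj.2]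
    · simp [Function.update_of_ne (posL_lt_posR i).ne]

theorem tprod_eq_pairInsert (i : Fin (n - 1)) (v : Fin n → V) :
    PiTensorProduct.tprod k v = pairInsert i v (v (posL i) ⊗ₜ v (posR i)) := by
  rw [pairInsert_tmul, Function.update_eq_self, Function.update_eq_self]

theorem formGt_localOp {f : V ⊗[k] V →ₗ[k] V ⊗[k] V} {g : W ⊗[k] W →ₗ[k] W ⊗[k] W}
    (h : ∀ x y, tensorSquare β (f x) y = tensorSquare β x (g y)) (i : Fin (n - 1))
    (u : ⨂[k]^n V) (z : ⨂[k]^n W) :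
    formGt β n (localOp f i u) z = formGt β n u (localOp g i z) := by
  induction u using PiTensorProduct.induction_on with
  | add a b ha hb => simp only [map_add, LinearMap.add_apply, ha, hb]
  | smul_tprod r v =>
  induction z using PiTensorProduct.induction_on with
  | add a b ha hb => simp only [map_add, ha, hb]
  | smul_tprod s w =>
    simp only [map_smul, LinearMap.smul_apply]
    rw [tprod_eq_pairInsert i v, tprod_eq_pairInsert i w, localOp_pairInsert, localOp_pairInsert,
      formGt_pairInsert, formGt_pairInsert, h]

/-- Reversal takes position `i` to `n - 1 - i` but index `i` to `n - 2 - i`. The difference of one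
turns left ends of neighbouring pairs into right ends. -/
theorem rev_posL (i : Fin (n - 1)) : Fin.rev (posL i) = posR (Fin.rev i) := by
  ext; simp [posL, posR]; omega

theorem rev_posR (i : Fin (n - 1)) : Fin.rev (posR i) = posL (Fin.rev i) := by
  ext; simp [posL, posR]; omega

/-- Reversal moves the pair to the reversed index and also exchanges its two members, hence the flip
`comm`. -/
theorem reindex_rev_pairInsert (i : Fin (n - 1)) (w : Fin n → W) (t : W ⊗[k] W) :
    PiTensorProduct.reindex k (fun _ => W) Fin.revPerm (pairInsert i w t) =
      pairInsert i.rev (fun j => w j.rev) (TensorProduct.comm k W W t) := by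
  induction t with
  | zero => simp
  | add x y hx hy => simp only [map_add, hx, hy]
  | tmul a b =>
    rw [pairInsert_tmul, PiTensorProduct.reindex_tprod, TensorProduct.comm_tmul, pairInsert_tmul]
    congr 1
    funext j
    have e : ∀ m : Fin n, j.rev = m ↔ j = m.rev := fun m => by rw [Fin.rev_eq_iff]
    simp only [Function.update_apply, Fin.revPerm_symm, Fin.revPerm_apply, e, rev_posL, rev_posR]
    have := (posL_lt_posR i.rev).ne
    split_ifs <;> simp_all

theorem reindex_rev_localOp (g : W ⊗[k] W →ₗ[k] W ⊗[k] W) (i : Fin (n - 1)) (z : ⨂[k]^n W) :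
    PiTensorProduct.reindex k (fun _ => W) Fin.revPerm (localOp g i z) =
      localOp ((TensorProduct.comm k W W).toLinearMap ∘ₗ g ∘ₗ (TensorProduct.comm k W W).toLinearMap)
        i.rev (PiTensorProduct.reindex k (fun _ => W) Fin.revPerm z) := by
  induction z using PiTensorProduct.induction_on with
  | add a b ha hb => simp only [map_add, ha, hb]
  | smul_tprod s w =>
    simp only [map_smul]
    rw [tprod_eq_pairInsert i w, localOp_pairInsert, reindex_rev_pairInsert, reindex_rev_pairInsert,
      localOp_pairInsert]
    simp

variable {β} {cV : Braiding k V} {cW : Braiding k W}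

theorem CaseA.formGt_localOp (h : CaseA cV cW β) (i : Fin (n - 1)) (u : ⨂[k]^n V)
    (z : ⨂[k]^n W) :
    formGt β n (localOp cV.c.toLinearMap i u) z = formGt β n u (localOp cW.c.toLinearMap i z) :=
  BraidedHopf.formGt_localOp β h i u z

/-- Absorbing the reversal into `z` leaves the form of case (a). There `c_V` has to be adjoint to
`c_W` conjugated by the flip, which is what case (b) asserts. -/
theorem CaseB.formLt_localOp (h : CaseB cV cW β) (i : Fin (n - 1)) (u : ⨂[k]^n V)
    (z : ⨂[k]^n W) :
    formLt β n (localOp cV.c.toLinearMap i u) z =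
      formLt β n u (localOp cW.c.toLinearMap i.rev z) := by
  simp only [formLt, LinearMap.compl₂_apply, LinearEquiv.coe_coe, reindex_rev_localOp, Fin.rev_rev]
  refine BraidedHopf.formGt_localOp β (fun x y => ?_) i u _
  -- Evaluating at the flipped `y` cancels the flip on the left, since it is an involution.
  have := h x (TensorProduct.comm k W W y)
  simpa using this

/-- If `σ_i` is adjoint to `σ_{ρ i}` and the permutation `ρ` of the indices is induced by an
automorphism of the symmetric group, then the quantum symmetrizers are adjoint. -/
theorem sym_adjoint {f : ⨂[k]^n V →ₗ[k] ⨂[k]^n W →ₗ[k] k} (ρ : Equiv.Perm (Fin (n - 1)))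
    (κ : Equiv.Perm (Fin n) ≃* Equiv.Perm (Fin n)) (hκ : ∀ i, κ (tau i) = tau (ρ i))
    (h : ∀ i u z, f (localOp cV.c.toLinearMap i u) z = f u (localOp cW.c.toLinearMap (ρ i) z))
    (u : ⨂[k]^n V) (z : ⨂[k]^n W) : f (cV.sym n u) z = f u (cW.sym n z) := by
  -- The adjoint of a composite is the composite of the adjoints in the opposite order, hence the
  -- reversed word.
  have word : ∀ (l : List (Fin (n - 1))) u z, f (cV.action n (l.map sigma).prod u) z =
      f u (cW.action n ((l.map ρ).reverse.map sigma).prod z) := by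
    intro l
    induction l with
    | nil => intro u z; simp
    | cons i l ih =>
      intro u z
      simp only [List.map_cons, List.prod_cons, List.reverse_cons, List.map_append, map_mul,
        List.prod_append, List.map_nil, List.prod_nil, mul_one, LinearEquiv.mul_apply,
        cV.action_sigma, cW.action_sigma]
      rw [h, ih]
  -- `κ` permutes the elementary transpositions, so words for `x` and for `κ x` correspond with
  -- equal lengths, and minimality is kept.
  have red : ∀ (l : List (Fin (n - 1))) x, IsReducedWord l x → IsReducedWord (l.map ρ) (κ x) := by
    have key : ∀ l : List (Fin (n - 1)), ((l.map ρ).map tau).prod = κ (l.map tau).prod := by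
      intro l
      rw [map_list_prod, List.map_map, List.map_map]
      congr 2
      funext i
      exact (hκ i).symm
    rintro l x ⟨rfl, hmin⟩
    refine ⟨key l, fun l' h' => ?_⟩
    have := hmin (l'.map ρ.symm) (κ.injective (by rw [← key, ← h']; simp [List.map_map]))
    simpa using this
  rw [cV.sym_apply, cW.sym_apply, map_sum, map_sum, LinearMap.sum_apply]
  -- The adjoint of the summand at `x` is the summand at `(κ x)⁻¹`, and `x ↦ (κ x)⁻¹` is a
  -- bijection.
  refine Eq.trans ?_ (Equiv.sum_comp (κ.toEquiv.trans (Equiv.inv _)) fun x =>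
    f u (cW.action n (braidSection x) z))
  refine Finset.sum_congr rfl fun x _ => ?_
  obtain ⟨l, hl⟩ := exists_isReducedWord x
  rw [braidSection_eq hl, word]
  congr 3
  exact (braidSection_eq (red l x hl).reverse).symm

theorem CaseA.sym_adjoint (h : CaseA cV cW β) (n : ℕ) (u : ⨂[k]^n V) (z : ⨂[k]^n W) :
    formGt β n (cV.sym n u) z = formGt β n u (cW.sym n z) :=
  BraidedHopf.sym_adjoint 1 (MulEquiv.refl _) (fun _ => rfl) h.formGt_localOp u z

/-- Index reversal comes from conjugation by the order-reversing permutation, which takes the swap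
of `i, i+1` to the swap of their mirror images. -/
theorem CaseB.sym_adjoint (h : CaseB cV cW β) (n : ℕ) (u : ⨂[k]^n V) (z : ⨂[k]^n W) :
    formLt β n (cV.sym n u) z = formLt β n u (cW.sym n z) := by
  refine BraidedHopf.sym_adjoint Fin.revPerm (MulAut.conj Fin.revPerm) (fun i => ?_)
    h.formLt_localOp u z
  rw [MulAut.conj_apply, tau, Equiv.mul_swap_eq_swap_mul, mul_inv_cancel_right, tau,
    Equiv.swap_comm]
  simp [rev_posL, rev_posR]

end FormLemmas

/-! ### Graded forms on the tensor algebras and their radicals -/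

section GradedForms

variable {k V W : Type*} [Field k] [AddCommGroup V] [Module k V] [AddCommGroup W] [Module k W]

theorem tensorSquare_comp {V' W' : Type*} [AddCommGroup V'] [Module k V'] [AddCommGroup W']
    [Module k W'] (β : V' →ₗ[k] W' →ₗ[k] k) (a : V →ₗ[k] V') (b : W →ₗ[k] W') (s : V ⊗[k] V)
    (t : W ⊗[k] W) :
    tensorSquare β (TensorProduct.map a a s) (TensorProduct.map b b t) =
      tensorSquare (β.compl₁₂ a b) s t := by
  induction s with
  | zero => simp
  | add x y hx hy => simp only [map_add, LinearMap.add_apply, hx, hy]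
  | tmul x y =>
  induction t with
  | zero => simp
  | add x y hx hy => simp only [map_add, hx, hy]
  | tmul x' y' => simp [tensorSquare_tmul]

/-- The value at `z ⊗ z'` depends only on the functionals attached to `z` and `z'`. In the
uniqueness proof this lets `apply_mul` determine values on products. -/
theorem tensorSquare_congr_right {β β' : V →ₗ[k] W →ₗ[k] k} {z z' : W}
    (h : ∀ u, β u z = β' u z) (h' : ∀ u, β u z' = β' u z') (s : V ⊗[k] V) :
    tensorSquare β s (z ⊗ₜ z') = tensorSquare β' s (z ⊗ₜ z') := by
  induction s with
  | zero => simp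
  | add x y hx hy => simp only [map_add, LinearMap.add_apply, hx, hy]
  | tmul x y => rw [tensorSquare_tmul, tensorSquare_tmul, h, h']

theorem tensorSquare_flip (β : V →ₗ[k] W →ₗ[k] k) (s : V ⊗[k] V) (t : W ⊗[k] W) :
    tensorSquare β.flip t s = tensorSquare β s t := by
  induction s with
  | zero => simp
  | add x y hx hy => simp only [map_add, LinearMap.add_apply, hx, hy]
  | tmul x y =>
  induction t with
  | zero => simp
  | add x y hx hy => simp only [map_add, LinearMap.add_apply, hx, hy]
  | tmul x' y' => simp [tensorSquare_tmul]

variable (f : ∀ n : ℕ, ⨂[k]^n V →ₗ[k] ⨂[k]^n W →ₗ[k] k)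

/-- The form on `A(V) × A(W)` given by `f n` in degree `n`, with different degrees orthogonal. -/
noncomputable def gradedForm : TensorAlg k V →ₗ[k] TensorAlg k W →ₗ[k] k :=
  DirectSum.toModule k ℕ _ fun n =>
    (f n).compl₂ (DirectSum.component k ℕ (fun n => ⨂[k]^n W) n)

theorem gradedForm_same (n : ℕ) (u : ⨂[k]^n V) (z : ⨂[k]^n W) :
    gradedForm f (incl k V n u) (incl k W n z) = f n u z := by
  rw [gradedForm, DirectSum.toModule_lof, LinearMap.compl₂_apply, DirectSum.component.lof_self]

theorem gradedForm_of_ne {m n : ℕ} (h : m ≠ n) (u : ⨂[k]^m V) (z : ⨂[k]^n W) :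
    gradedForm f (incl k V m u) (incl k W n z) = 0 := by
  rw [gradedForm, DirectSum.toModule_lof, LinearMap.compl₂_apply, DirectSum.component.of,
    dif_neg h.symm, map_zero]

/-- Separates the symmetrizer from the pairing of tensors: radicals and products are studied for
`gradedForm`, which involves no braiding. -/
theorem totalForm_eq (cV : Braiding k V) (u : TensorAlg k V) (z : TensorAlg k W) :
    totalForm cV f u z = gradedForm f (cV.symTotal u) z := by
  induction u using DirectSum.induction_on with
  | zero => simp
  | add x y hx hy => simp only [map_add, LinearMap.add_apply, hx, hy]
  | of m u =>
  induction z using DirectSum.induction_on with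
  | zero => simp
  | add x y hx hy => simp only [map_add, hx, hy]
  | of n z =>
    change totalForm cV f (incl k V m u) (incl k W n z) =
      gradedForm f (cV.symTotal (incl k V m u)) (incl k W n z)
    rw [cV.symTotal_incl]
    by_cases h : m = n
    · subst h
      rw [totalForm_same, gradedForm_same]
    · rw [totalForm_of_ne _ _ h, gradedForm_of_ne _ h]

/-- Different degrees are orthogonal, so testing against degree `n` sees only the component of `u`
in degree `n`. -/
theorem gradedForm_separatingLeft (hf : ∀ n, (f n).SeparatingLeft) :
    (gradedForm f).SeparatingLeft := by
  intro u hu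
  refine DFinsupp.ext fun n => hf n _ fun z => ?_
  rw [← hu (incl k W n z)]
  clear hu
  induction u using DirectSum.induction_on with
  | zero => simp
  | add x y hx hy =>
    rw [DFinsupp.add_apply, map_add, map_add, LinearMap.add_apply, LinearMap.add_apply, hx, hy]
  | of m u =>
    change f n ((incl k V m u) n) z = gradedForm f (incl k V m u) (incl k W n z)
    by_cases h : m = n
    · subst h
      rw [gradedForm_same]
      congr 2
      exact DFinsupp.single_eq_same
    · rw [gradedForm_of_ne _ h]
      have : (incl k V m u) n = 0 := DFinsupp.single_eq_of_ne (Ne.symm h)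
      rw [this, map_zero, LinearMap.zero_apply]

theorem ker_totalForm (cV : Braiding k V) (hf : ∀ n, (f n).SeparatingLeft) :
    LinearMap.ker (totalForm cV f) = LinearMap.ker cV.symTotal := by
  ext u
  rw [LinearMap.mem_ker, LinearMap.mem_ker]
  constructor
  · intro h
    refine gradedForm_separatingLeft f hf _ fun z => ?_
    rw [← totalForm_eq, h, LinearMap.zero_apply]
  · intro h
    refine LinearMap.ext fun z => ?_
    simp [totalForm_eq, h]

/-- Adjointness moves the symmetrizer to the other argument. Statements about the second argument
thereby follow from those about the first with `V` and `W` exchanged. -/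
theorem totalForm_flip {cV : Braiding k V} {cW : Braiding k W}
    (h : ∀ n u z, f n (cV.sym n u) z = f n u (cW.sym n z)) :
    (totalForm cV f).flip = totalForm cW fun n => (f n).flip := by
  refine LinearMap.ext fun z => ?_
  refine LinearMap.ext fun u => ?_
  induction u using DirectSum.induction_on with
  | zero => simp
  | add x y hx hy => simp only [map_add, hx, hy]
  | of m u =>
  induction z using DirectSum.induction_on with
  | zero => simp
  | add x y hx hy => simp only [map_add, LinearMap.add_apply, hx, hy]
  | of n z =>
    change totalForm cV f (incl k V m u) (incl k W n z) =
      totalForm cW (fun n => (f n).flip) (incl k W n z) (incl k V m u)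
    by_cases e : m = n
    · subst e
      rw [totalForm_same, totalForm_same, h, LinearMap.flip_apply]
    · rw [totalForm_of_ne _ _ e, totalForm_of_ne _ _ (Ne.symm e)]

/-! ### Compatibility with products and coproducts -/

theorem tensorSquare_gradedForm_of_ne {a b p q : ℕ} (h : a ≠ p ∨ b ≠ q)
    (s : ⨂[k]^a V ⊗[k] ⨂[k]^b V) (z : ⨂[k]^p W) (z' : ⨂[k]^q W) :
    tensorSquare (gradedForm f) (TensorProduct.map (incl k V a) (incl k V b) s)
      (incl k W p z ⊗ₜ incl k W q z') = 0 := by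
  induction s with
  | zero => simp
  | add x y hx hy => simp only [map_add, LinearMap.add_apply, hx, hy, add_zero]
  | tmul x y =>
    rw [TensorProduct.map_tmul, tensorSquare_tmul]
    rcases h with h | h
    · rw [gradedForm_of_ne _ h, zero_mul]
    · rw [gradedForm_of_ne _ h, mul_zero]

theorem tensorSquare_deconcat_incl (n : ℕ) (t : ⨂[k]^n V) (s : TensorAlg k W ⊗[k] TensorAlg k W) :
    tensorSquare (gradedForm f) (deconcat k V (incl k V n t)) s =
      ∑ p ∈ Finset.HasAntidiagonal.antidiagonal n, tensorSquare (gradedForm f)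
        (TensorProduct.map (incl k V p.1) (incl k V p.2)
          (TensorPower.mulEquiv.symm (regrade k V n (p.1 + p.2) t))) s := by
  rw [deconcat, DirectSum.toModule_lof, LinearMap.sum_apply, map_sum, LinearMap.sum_apply]
  rfl

theorem tensorSquare_deconcat_of_ne {n p q : ℕ} (h : n ≠ p + q) (t : ⨂[k]^n V) (z : ⨂[k]^p W)
    (z' : ⨂[k]^q W) :
    tensorSquare (gradedForm f) (deconcat k V (incl k V n t))
      (incl k W p z ⊗ₜ incl k W q z') = 0 := by
  rw [tensorSquare_deconcat_incl]
  refine Finset.sum_eq_zero ?_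
  rintro ⟨a, b⟩ hab
  rw [Finset.HasAntidiagonal.mem_antidiagonal] at hab
  exact tensorSquare_gradedForm_of_ne f (by simp only at hab ⊢; omega) _ _ _

/-- By orthogonality of degrees only the cut at `(p, q)` survives, and there deconcatenation undoes
the concatenation of `x` and `y`. -/
theorem tensorSquare_deconcat_mulEquiv {p q : ℕ} (x : ⨂[k]^p V) (y : ⨂[k]^q V) (z : ⨂[k]^p W)
    (z' : ⨂[k]^q W) :
    tensorSquare (gradedForm f) (deconcat k V (incl k V (p + q) (TensorPower.mulEquiv (x ⊗ₜ y))))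
      (incl k W p z ⊗ₜ incl k W q z') = f p x z * f q y z' := by
  rw [tensorSquare_deconcat_incl, Finset.sum_eq_single (p, q)]
  · simp only
    rw [regrade_self, LinearEquiv.symm_apply_apply, TensorProduct.map_tmul, tensorSquare_tmul,
      gradedForm_same, gradedForm_same]
  · rintro ⟨a, b⟩ _ hne
    refine tensorSquare_gradedForm_of_ne f ?_ _ _ _
    by_contra hc
    push Not at hc
    exact hne (Prod.ext hc.1 hc.2)
  · intro h
    rw [Finset.HasAntidiagonal.mem_antidiagonal] at h
    exact absurd rfl h

/-- Multiplication in `A(W)` is adjoint to deconcatenation in `A(V)`. Both sides are trilinear and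
vanish on homogeneous elements unless `n = p + q`; then `u` is a sum of concatenations, for which
this is `hf`. -/
theorem gradedForm_mul
    (hf : ∀ p q (x : ⨂[k]^p V) (y : ⨂[k]^q V) (z : ⨂[k]^p W) (z' : ⨂[k]^q W),
      gradedForm f (incl k V p x * incl k V q y) (incl k W p z * incl k W q z') =
        f p x z * f q y z')
    (u : TensorAlg k V) (z z' : TensorAlg k W) :
    gradedForm f u (z * z') = tensorSquare (gradedForm f) (deconcat k V u) (z ⊗ₜ z') := by
  induction u using DirectSum.induction_on with
  | zero => simp
  | add x y hx hy => simp only [map_add, LinearMap.add_apply, hx, hy]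
  | of n u =>
  induction z using DirectSum.induction_on with
  | zero => simp
  | add x y hx hy => simp only [add_mul, TensorProduct.add_tmul, map_add, hx, hy]
  | of p z =>
  induction z' using DirectSum.induction_on with
  | zero => simp
  | add x y hx hy => simp only [mul_add, TensorProduct.tmul_add, map_add, hx, hy]
  | of q z' =>
    change gradedForm f (incl k V n u) (incl k W p z * incl k W q z') = tensorSquare (gradedForm f)
      (deconcat k V (incl k V n u)) (incl k W p z ⊗ₜ incl k W q z')
    by_cases h : n = p + q
    · subst h
      obtain ⟨t, rfl⟩ := TensorPower.mulEquiv.surjective u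
      induction t with
      | zero => simp
      | add x y hx hy => simp only [map_add, LinearMap.add_apply, hx, hy]
      | tmul x y => rw [tensorSquare_deconcat_mulEquiv, ← hf, incl_mul_incl, incl_mul_incl]
    · rw [tensorSquare_deconcat_of_ne f h, incl_mul_incl, gradedForm_of_ne _ h]

/-- The variant for forms pairing the first block on one side with the last block on the other. The
hypothesis is phrased with products in the tensor algebra because the two arguments lie in degrees
`p + q` and `q + p`. -/
theorem gradedForm_mul_swap
    (hf : ∀ p q (x : ⨂[k]^p V) (y : ⨂[k]^q V) (z : ⨂[k]^p W) (z' : ⨂[k]^q W),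
      gradedForm f (incl k V p x * incl k V q y) (incl k W q z' * incl k W p z) =
        f p x z * f q y z')
    (u : TensorAlg k V) (z z' : TensorAlg k W) :
    gradedForm f u (z * z') = tensorSquare (gradedForm f) (deconcat k V u) (z' ⊗ₜ z) := by
  induction u using DirectSum.induction_on with
  | zero => simp
  | add x y hx hy => simp only [map_add, LinearMap.add_apply, hx, hy]
  | of n u =>
  induction z using DirectSum.induction_on with
  | zero => simp
  | add x y hx hy => simp only [add_mul, TensorProduct.tmul_add, map_add, hx, hy]
  | of q z =>
  induction z' using DirectSum.induction_on with
  | zero => simp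
  | add x y hx hy => simp only [mul_add, TensorProduct.add_tmul, map_add, hx, hy]
  | of p z' =>
    change gradedForm f (incl k V n u) (incl k W q z * incl k W p z') = tensorSquare (gradedForm f)
      (deconcat k V (incl k V n u)) (incl k W p z' ⊗ₜ incl k W q z)
    by_cases h : n = p + q
    · subst h
      obtain ⟨t, rfl⟩ := TensorPower.mulEquiv.surjective u
      induction t with
      | zero => simp
      | add x y hx hy => simp only [map_add, LinearMap.add_apply, hx, hy]
      | tmul x y => rw [tensorSquare_deconcat_mulEquiv, ← hf, incl_mul_incl, incl_mul_incl]
    · rw [tensorSquare_deconcat_of_ne f h, incl_mul_incl, gradedForm_of_ne _ (by omega)]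

/-- Each leg of the comultiplication acquires one symmetrizer from `totalForm`. Since `𝔖` is a
coalgebra morphism to deconcatenation, both are absorbed into a single one on `u`. -/
theorem tensorSquare_totalForm (cV : Braiding k V) (u : TensorAlg k V)
    (s : TensorAlg k W ⊗[k] TensorAlg k W) :
    tensorSquare (totalForm cV f) (cV.comul u) s =
      tensorSquare (gradedForm f) (deconcat k V (cV.symTotal u)) s := by
  have e : totalForm cV f = (gradedForm f).compl₁₂ cV.symTotal LinearMap.id := by
    refine LinearMap.ext fun u => ?_
    refine LinearMap.ext fun z => ?_
    exact totalForm_eq f cV u z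
  rw [cV.deconcat_symTotal, e, ← tensorSquare_comp, TensorProduct.map_id, LinearMap.id_apply]

theorem gradedForm_formGt_mul (β : V →ₗ[k] W →ₗ[k] k) (p q : ℕ) (x : ⨂[k]^p V) (y : ⨂[k]^q V)
    (z : ⨂[k]^p W) (z' : ⨂[k]^q W) :
    gradedForm (formGt β) (incl k V p x * incl k V q y) (incl k W p z * incl k W q z') =
      formGt β p x z * formGt β q y z' := by
  rw [incl_mul_incl, incl_mul_incl, gradedForm_same, formGt_mulEquiv]

/-- Reversing a concatenation concatenates the reversed blocks in the opposite order. So `x`, the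
first block, meets `z`, the last one. -/
theorem gradedForm_formLt_mul (β : V →ₗ[k] W →ₗ[k] k) (p q : ℕ) (x : ⨂[k]^p V) (y : ⨂[k]^q V)
    (z : ⨂[k]^p W) (z' : ⨂[k]^q W) :
    gradedForm (formLt β) (incl k V p x * incl k V q y) (incl k W q z' * incl k W p z) =
      formLt β p x z * formLt β q y z' := by
  induction x using PiTensorProduct.induction_on with
  | add a b ha hb => simp only [add_mul, map_add, LinearMap.add_apply, ha, hb]
  | smul_tprod r v =>
  induction y using PiTensorProduct.induction_on with
  | add a b ha hb => simp only [mul_add, map_add, LinearMap.add_apply, ha, hb]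
  | smul_tprod r' v' =>
  induction z using PiTensorProduct.induction_on with
  | add a b ha hb => simp only [mul_add, map_add, ha, hb, add_mul]
  | smul_tprod s w =>
  induction z' using PiTensorProduct.induction_on with
  | add a b ha hb => simp only [add_mul, map_add, ha, hb, mul_add]
  | smul_tprod s' w' =>
    have key : gradedForm (formLt β)
        (incl k V p (PiTensorProduct.tprod k v) * incl k V q (PiTensorProduct.tprod k v'))
        (incl k W q (PiTensorProduct.tprod k w') * incl k W p (PiTensorProduct.tprod k w)) =
        (∏ i, β (v i) (w i.rev)) * ∏ i, β (v' i) (w' i.rev) := by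
      rw [incl_mul_incl, incl_mul_incl, mulEquiv_tprod, mulEquiv_tprod,
        incl_tprod_cast (Nat.add_comm p q), gradedForm_same, formLt_tprod, Fin.prod_univ_add]
      congr 1
      · refine Finset.prod_congr rfl fun i _ => ?_
        -- `p + q - 1 - i = q + (p - 1 - i)`: the mirror image of the first `p` positions is the
        -- last `p`.
        have : Fin.cast (Nat.add_comm p q) (Fin.castAdd q i).rev = Fin.natAdd q i.rev := by
          ext; simp; omega
        rw [this, Fin.append_left, Fin.append_right]
      · refine Finset.prod_congr rfl fun i _ => ?_
        have : Fin.cast (Nat.add_comm p q) (Fin.natAdd p i).rev = Fin.castAdd p i.rev := by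
          ext; simp; omega
        rw [this, Fin.append_left, Fin.append_right]
    simp only [map_smul, LinearMap.smul_apply, smul_mul_assoc, mul_smul_comm, key, formLt_tprod,
      smul_eq_mul]
    ring

end GradedForms

/-! ## Pairings of the quotients -/

section Pairings

variable {k V W : Type*} [Field k] [AddCommGroup V] [Module k V] [AddCommGroup W] [Module k W]
  {cV : Braiding k V} {cW : Braiding k W}

variable (k V) in
theorem one_eq_incl : (1 : TensorAlg k V) = incl k V 0 (PiTensorProduct.tprod k Fin.elim0) := rfl

theorem exists_incl_zero_eq (t : ⨂[k]^0 V) : ∃ r : k, incl k V 0 t = r • 1 := by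
  obtain ⟨r, rfl⟩ := (PiTensorProduct.isEmptyEquiv (Fin 0)).symm.surjective t
  refine ⟨r, ?_⟩
  rw [PiTensorProduct.isEmptyEquiv_symm_apply, map_smul, one_eq_incl]
  congr 3

theorem Braiding.one_mem_degree : (1 : cV.Toba) ∈ cV.degree 0 :=
  ⟨PiTensorProduct.tprod k Fin.elim0, map_one cV.proj⟩

theorem Braiding.deg1_mem_degree (v : V) : cV.deg1 v ∈ cV.degree 1 := ⟨_, rfl⟩

theorem Braiding.exists_deg1_eq (t : ⨂[k]^1 V) : ∃ v, cV.proj (incl k V 1 t) = cV.deg1 v := by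
  obtain ⟨v, rfl⟩ :=
    (PiTensorProduct.subsingletonEquiv (R := k) (s := fun _ : Fin 1 => V) 0).symm.surjective t
  exact ⟨v, rfl⟩

/-- Induction along the generation of `𝔅(V)` by its component of degree one. -/
theorem Braiding.toba_induction {p : cV.Toba → Prop} (add : ∀ x y, p x → p y → p (x + y))
    (smul : ∀ (r : k) x, p x → p (r • x)) (one : p 1) (deg1 : ∀ v, p (cV.deg1 v))
    (mul : ∀ x y, p x → p y → p (x * y)) (x : cV.Toba) : p x := by
  obtain ⟨x, rfl⟩ := cV.proj_surjective x
  induction x using DirectSum.induction_on with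
  | zero => simpa using smul 0 1 one
  | add x y hx hy => rw [map_add]; exact add _ _ hx hy
  | of n t =>
    change p (cV.proj (incl k V n t))
    induction n with
    | zero =>
      obtain ⟨r, hr⟩ := exists_incl_zero_eq t
      rw [hr, map_smul, map_one]
      exact smul r 1 one
    | succ n ih =>
      -- The last tensor factor is split off as a right multiplication by an element of degree one.
      obtain ⟨t, rfl⟩ := (TensorPower.mulEquiv (n := n) (m := 1)).surjective t
      induction t with
      | zero => simpa using smul 0 1 one
      | add x y hx hy => rw [map_add, map_add, map_add]; exact add _ _ hx hy
      | tmul x y =>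
        rw [← incl_mul_incl, map_mul]
        obtain ⟨v, hv⟩ := cV.exists_deg1_eq y
        rw [hv]
        exact mul _ _ (ih x) (deg1 v)

theorem Braiding.toba_induction_degree {p : cV.Toba → Prop}
    (add : ∀ x y, p x → p y → p (x + y)) (degree : ∀ n, ∀ x ∈ cV.degree n, p x) (x : cV.Toba) :
    p x := by
  obtain ⟨x, rfl⟩ := cV.proj_surjective x
  induction x using DirectSum.induction_on with
  | zero => rw [map_zero]; exact degree 0 0 (zero_mem _)
  | add x y hx hy => rw [map_add]; exact add _ _ hx hy
  | of n t => exact degree n _ ⟨t, rfl⟩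

theorem Braiding.mem_degree_zero {x : cV.Toba} (hx : x ∈ cV.degree 0) : ∃ r : k, x = r • 1 := by
  obtain ⟨t, rfl⟩ := hx
  obtain ⟨r, hr⟩ := exists_incl_zero_eq t
  refine ⟨r, ?_⟩
  change cV.proj (incl k V 0 t) = _
  rw [hr, map_smul, map_one]

theorem Braiding.mem_degree_one {x : cV.Toba} (hx : x ∈ cV.degree 1) : ∃ v, x = cV.deg1 v := by
  obtain ⟨t, rfl⟩ := hx
  exact cV.exists_deg1_eq t

/-! ### Uniqueness of the pairing -/

variable {β : V →ₗ[k] W →ₗ[k] k} {P P' : cV.Toba →ₗ[k] cW.Toba →ₗ[k] k}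

/-- Orthogonality of degrees and the normalizations settle `z = 1` and `z` of degree one, which
generate `𝔅(W)`. The assumption `mul` carries agreement over to products. -/
theorem IsGradedPairing.ext_of_mul (hP : IsGradedPairing cV cW β P)
    (hP' : IsGradedPairing cV cW β P')
    (mul : ∀ z z', (∀ u, P u z = P' u z) → (∀ u, P u z' = P' u z') →
      ∀ u, P u (z * z') = P' u (z * z')) : P = P' := by
  refine LinearMap.ext fun u => ?_
  refine LinearMap.ext fun z => ?_
  -- The inductive statement has to hold for all `u` at once: the product step uses it at the legs
  -- of the coproduct of `u`.
  revert u
  induction z using cW.toba_induction with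
  | add x y hx hy => intro u; rw [map_add, map_add, hx, hy]
  | smul r x hx => intro u; rw [map_smul, map_smul, hx]
  | mul x y hx hy => exact mul x y hx hy
  | one =>
    intro u
    induction u using cV.toba_induction_degree with
    | add x y hx hy => rw [map_add, map_add, LinearMap.add_apply, LinearMap.add_apply, hx, hy]
    | degree n x hx =>
      by_cases h : n = 0
      · subst h
        obtain ⟨r, rfl⟩ := cV.mem_degree_zero hx
        rw [map_smul, map_smul, LinearMap.smul_apply, LinearMap.smul_apply, hP.one_one,
          hP'.one_one]
      · rw [hP.graded n 0 h x hx 1 cW.one_mem_degree, hP'.graded n 0 h x hx 1 cW.one_mem_degree]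
  | deg1 w =>
    intro u
    induction u using cV.toba_induction_degree with
    | add x y hx hy => rw [map_add, map_add, LinearMap.add_apply, LinearMap.add_apply, hx, hy]
    | degree n x hx =>
      by_cases h : n = 1
      · subst h
        obtain ⟨v, rfl⟩ := cV.mem_degree_one hx
        rw [hP.deg_one, hP'.deg_one]
      · rw [hP.graded n 1 h x hx _ (cW.deg1_mem_degree w),
          hP'.graded n 1 h x hx _ (cW.deg1_mem_degree w)]

theorem IsPairingA.unique (hP : IsPairingA cV cW β P) (hP' : IsPairingA cV cW β P') : P = P' :=
  hP.toIsGradedPairing.ext_of_mul hP'.toIsGradedPairing fun z z' h h' u => by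
    rw [hP.apply_mul, hP'.apply_mul, tensorSquare_congr_right h h']

theorem IsPairingB.unique (hP : IsPairingB cV cW β P) (hP' : IsPairingB cV cW β P') : P = P' :=
  hP.toIsGradedPairing.ext_of_mul hP'.toIsGradedPairing fun z z' h h' u => by
    rw [hP.apply_mul, hP'.apply_mul, tensorSquare_congr_right h' h]

/-! ### Descent to the quotients and verification of the axioms -/

/-- A form on `A(V) × A(W)` whose radicals are the kernels of the symmetrizers induces a form on
the quotients. -/
theorem exists_descend {T : TensorAlg k V →ₗ[k] TensorAlg k W →ₗ[k] k}
    (hl : LinearMap.ker T = LinearMap.ker cV.symTotal)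
    (hr : LinearMap.ker T.flip = LinearMap.ker cW.symTotal) :
    ∃ P : cV.Toba →ₗ[k] cW.Toba →ₗ[k] k, P.Nondegenerate ∧
      ∀ u z, P (cV.proj u) (cW.proj z) = T u z := by
  obtain ⟨g, hg⟩ := exists_comp_eq_of_ker_le cV.proj.toLinearMap T fun u hu => by
    rw [hl]; exact (cV.proj_eq_zero_iff u).1 hu
  -- `g` already has its first argument in `𝔅(V)`. It kills `ker 𝔖` in the second argument because
  -- every element of `𝔅(V)` lifts to `A(V)`, where `g` becomes `T`.
  obtain ⟨P, hP⟩ := exists_comp_eq_of_ker_le cW.proj.toLinearMap g.flip fun z hz => by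
    have hz' : T.flip z = 0 := by
      have : z ∈ LinearMap.ker T.flip := by rw [hr]; exact (cW.proj_eq_zero_iff z).1 hz
      exact this
    rw [LinearMap.mem_ker]
    refine LinearMap.ext fun u => ?_
    obtain ⟨u, rfl⟩ := cV.proj_surjective u
    change g (cV.proj.toLinearMap u) z = 0
    rw [← LinearMap.comp_apply, hg]
    exact LinearMap.congr_fun hz' u
  have e : ∀ u z, P.flip (cV.proj u) (cW.proj z) = T u z := fun u z => by
    rw [← hg]
    exact LinearMap.congr_fun (LinearMap.congr_fun hP z) (cV.proj u)
  refine ⟨P.flip, ⟨fun u hu => ?_, fun z hz => ?_⟩, e⟩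
  · obtain ⟨u, rfl⟩ := cV.proj_surjective u
    rw [cV.proj_eq_zero_iff, ← LinearMap.mem_ker, ← hl, LinearMap.mem_ker]
    refine LinearMap.ext fun z => ?_
    rw [← e, hu, LinearMap.zero_apply]
  · obtain ⟨z, rfl⟩ := cW.proj_surjective z
    rw [cW.proj_eq_zero_iff, ← LinearMap.mem_ker, ← hr, LinearMap.mem_ker]
    refine LinearMap.ext fun u => ?_
    rw [LinearMap.flip_apply, ← e, hz, LinearMap.zero_apply]

/-- In degrees zero and one the symmetric group is trivial, so the normalizations of the pairing do
not see the braiding. -/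
theorem Braiding.sym_of_subsingleton (c : Braiding k V) {n : ℕ} [Subsingleton (Fin n)]
    (t : ⨂[k]^n V) : c.sym n t = t := by
  rw [c.sym_apply, Fintype.sum_subsingleton _ (1 : Equiv.Perm (Fin n)), braidSection_one, map_one]
  rfl

theorem isGradedPairing_of_totalForm {f : ∀ n : ℕ, ⨂[k]^n V →ₗ[k] ⨂[k]^n W →ₗ[k] k}
    (h0 : ∀ v w, f 0 (PiTensorProduct.tprod k v) (PiTensorProduct.tprod k w) = 1)
    (h1 : ∀ v w, f 1 (PiTensorProduct.tprod k v) (PiTensorProduct.tprod k w) = β (v 0) (w 0))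
    (hP : P.Nondegenerate) (h : ∀ u z, P (cV.proj u) (cW.proj z) = totalForm cV f u z) :
    IsGradedPairing cV cW β P where
  nondegenerate := hP
  one_one := by
    rw [← map_one cV.proj, ← map_one cW.proj, h, one_eq_incl, one_eq_incl, totalForm_same,
      cV.sym_of_subsingleton, h0]
  graded := by
    rintro i j hij _ ⟨u, rfl⟩ _ ⟨z, rfl⟩
    exact (h _ _).trans (totalForm_of_ne cV f hij u z)
  deg_one v w := by
    refine (h _ _).trans ((totalForm_same _ _ _ _ _).trans ?_)
    rw [cV.sym_of_subsingleton]
    simp only [LinearEquiv.coe_coe, PiTensorProduct.subsingletonEquiv_symm_apply, h1,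
      Function.update_self]

theorem tensorSquare_tobaComul {T : TensorAlg k V →ₗ[k] TensorAlg k W →ₗ[k] k}
    (h : ∀ u z, P (cV.proj u) (cW.proj z) = T u z) (u : TensorAlg k V) (z z' : TensorAlg k W) :
    tensorSquare P (cV.tobaComul (cV.proj u)) (cW.proj z ⊗ₜ cW.proj z') =
      tensorSquare T (cV.comul u) (z ⊗ₜ z') := by
  have e : T = P.compl₁₂ cV.proj.toLinearMap cW.proj.toLinearMap := by
    refine LinearMap.ext fun u => ?_
    refine LinearMap.ext fun z => ?_
    exact (h u z).symm
  rw [cV.tobaComul_proj, e, ← tensorSquare_comp, TensorProduct.map_tmul]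
  rfl

/-- After lifting to the tensor algebras, both sides become the plain graded form evaluated at `𝔖
u`: the left by definition, the right by the coalgebra property of `𝔖`. What remains is `hf`. -/
theorem apply_mul_of_totalForm {f : ∀ n : ℕ, ⨂[k]^n V →ₗ[k] ⨂[k]^n W →ₗ[k] k}
    (hf : ∀ u z z', gradedForm f u (z * z') =
      tensorSquare (gradedForm f) (deconcat k V u) (z ⊗ₜ z'))
    (h : ∀ u z, P (cV.proj u) (cW.proj z) = totalForm cV f u z) (u : cV.Toba) (z z' : cW.Toba) :
    P u (z * z') = tensorSquare P (cV.tobaComul u) (z ⊗ₜ z') := by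
  obtain ⟨u, rfl⟩ := cV.proj_surjective u
  obtain ⟨z, rfl⟩ := cW.proj_surjective z
  obtain ⟨z', rfl⟩ := cW.proj_surjective z'
  rw [tensorSquare_tobaComul h, tensorSquare_totalForm, ← map_mul, h, totalForm_eq, hf]

theorem apply_mul_swap_of_totalForm {f : ∀ n : ℕ, ⨂[k]^n V →ₗ[k] ⨂[k]^n W →ₗ[k] k}
    (hf : ∀ u z z', gradedForm f u (z * z') =
      tensorSquare (gradedForm f) (deconcat k V u) (z' ⊗ₜ z))
    (h : ∀ u z, P (cV.proj u) (cW.proj z) = totalForm cV f u z) (u : cV.Toba) (z z' : cW.Toba) :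
    P u (z * z') = tensorSquare P (cV.tobaComul u) (z' ⊗ₜ z) := by
  obtain ⟨u, rfl⟩ := cV.proj_surjective u
  obtain ⟨z, rfl⟩ := cW.proj_surjective z
  obtain ⟨z', rfl⟩ := cW.proj_surjective z'
  rw [tensorSquare_tobaComul h, tensorSquare_totalForm, ← map_mul, h, totalForm_eq, hf]

theorem CaseA.totalForm_flip (h : CaseA cV cW β) :
    (totalForm cV (formGt β)).flip = totalForm cW (formGt β.flip) := by
  rw [BraidedHopf.totalForm_flip _ h.sym_adjoint]
  simp only [formGt_flip]

theorem CaseB.totalForm_flip (h : CaseB cV cW β) :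
    (totalForm cV (formLt β)).flip = totalForm cW (formLt β.flip) := by
  rw [BraidedHopf.totalForm_flip _ h.sym_adjoint]
  simp only [formLt_flip]

theorem CaseA.isPairingA (h : CaseA cV cW β) (hP : P.Nondegenerate)
    (hT : ∀ u z, P (cV.proj u) (cW.proj z) = totalForm cV (formGt β) u z) :
    IsPairingA cV cW β P where
  toIsGradedPairing := isGradedPairing_of_totalForm (fun v w => by simp [formGt_tprod])
    (fun v w => by simp [formGt_tprod]) hP hT
  apply_mul := apply_mul_of_totalForm (gradedForm_mul _ (gradedForm_formGt_mul β)) hT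
  mul_apply u u' z := by
    -- The rule for products in the first argument is the rule for the second, applied to the
    -- flipped pairing, which is induced by the form of `W`, `V` and `β.flip`.
    have := apply_mul_of_totalForm (P := P.flip)
      (gradedForm_mul _ (gradedForm_formGt_mul β.flip)) (fun z u => by
        rw [← h.totalForm_flip]; exact hT u z) z u u'
    rw [tensorSquare_flip] at this
    exact this

theorem CaseB.isPairingB (h : CaseB cV cW β) (hP : P.Nondegenerate)
    (hT : ∀ u z, P (cV.proj u) (cW.proj z) = totalForm cV (formLt β) u z) :
    IsPairingB cV cW β P where
  toIsGradedPairing := isGradedPairing_of_totalForm (fun v w => by simp [formLt_tprod])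
    (fun v w => by simp [formLt_tprod]) hP hT
  apply_mul := apply_mul_swap_of_totalForm (gradedForm_mul_swap _ (gradedForm_formLt_mul β)) hT
  mul_apply u u' z := by
    have := apply_mul_swap_of_totalForm (P := P.flip)
      (gradedForm_mul_swap _ (gradedForm_formLt_mul β.flip)) (fun z u => by
        rw [← h.totalForm_flip]; exact hT u z) z u u'
    rw [tensorSquare_flip] at this
    exact this

end Pairings

end BraidedHopf

/-! ### The main theorem -/

theorem mainTheorem6 {k V W : Type*} [Field k] [AddCommGroup V] [Module k V] [AddCommGroup W]
    [Module k W] (cV : BraidedHopf.Braiding k V) (cW : BraidedHopf.Braiding k W)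
    (β : V →ₗ[k] W →ₗ[k] k) (hβ : β.Nondegenerate) :
    (BraidedHopf.CaseA cV cW β →
      (∃! P : cV.Toba →ₗ[k] cW.Toba →ₗ[k] k, BraidedHopf.IsPairingA cV cW β P) ∧
      (∀ P : cV.Toba →ₗ[k] cW.Toba →ₗ[k] k, BraidedHopf.IsPairingA cV cW β P →
        ∀ (u : BraidedHopf.TensorAlg k V) (z : BraidedHopf.TensorAlg k W),
          P (cV.proj u) (cW.proj z) =
            BraidedHopf.totalForm cV (BraidedHopf.formGt β) u z) ∧
      LinearMap.ker (BraidedHopf.totalForm cV (BraidedHopf.formGt β)) =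
        LinearMap.ker cV.symTotal ∧
      LinearMap.ker (BraidedHopf.totalForm cV (BraidedHopf.formGt β)).flip =
        LinearMap.ker cW.symTotal) ∧
    (BraidedHopf.CaseB cV cW β →
      (∃! P : cV.Toba →ₗ[k] cW.Toba →ₗ[k] k, BraidedHopf.IsPairingB cV cW β P) ∧
      (∀ P : cV.Toba →ₗ[k] cW.Toba →ₗ[k] k, BraidedHopf.IsPairingB cV cW β P →
        ∀ (u : BraidedHopf.TensorAlg k V) (z : BraidedHopf.TensorAlg k W),
          P (cV.proj u) (cW.proj z) =
            BraidedHopf.totalForm cV (BraidedHopf.formLt β) u z) ∧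
      LinearMap.ker (BraidedHopf.totalForm cV (BraidedHopf.formLt β)) =
        LinearMap.ker cV.symTotal ∧
      LinearMap.ker (BraidedHopf.totalForm cV (BraidedHopf.formLt β)).flip =
        LinearMap.ker cW.symTotal) := by
  refine ⟨fun h => ?_, fun h => ?_⟩
  · have hl := BraidedHopf.ker_totalForm _ cV (BraidedHopf.formGt_separatingLeft β hβ.1)
    have hr := BraidedHopf.ker_totalForm _ cW
      (BraidedHopf.formGt_separatingLeft β.flip hβ.2)
    -- `hr` computes a left radical for `W` and `β.flip`; by adjointness it is the right radical of
    -- the original form.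
    rw [← h.totalForm_flip] at hr
    obtain ⟨P, hP, hT⟩ := BraidedHopf.exists_descend hl hr
    have hA := h.isPairingA hP hT
    -- Any pairing equals the constructed `P` by uniqueness, so it is induced by `totalForm`.
    exact ⟨⟨P, hA, fun P' hP' => hP'.unique hA⟩, fun P' hP' => hP'.unique hA ▸ hT, hl, hr⟩
  · have hl := BraidedHopf.ker_totalForm _ cV (BraidedHopf.formLt_separatingLeft β hβ.1)
    have hr := BraidedHopf.ker_totalForm _ cW
      (BraidedHopf.formLt_separatingLeft β.flip hβ.2)
    rw [← h.totalForm_flip] at hr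
    obtain ⟨P, hP, hT⟩ := BraidedHopf.exists_descend hl hr
    have hB := h.isPairingB hP hT
    exact ⟨⟨P, hB, fun P' hP' => hP'.unique hB⟩, fun P' hP' => hP'.unique hB ▸ hT, hl, hr⟩
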